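/- Let the diamond hierarchical graphs $D_m$ be defined as follows: $D_0$ consists of two vertices joined by one edge, and $D_{m+1}$ is obtained from $D_m$ by replacing every edge $\{a,b\}$ by two new vertices, each of which is joined by an edge to $a$ and to $b$. For a finite graph $G=(V,E)$ let $$Z(G,q,v)=\sum_{A\subseteq E} q^{k(A)}v^{|A|}$$ be the Potts model partition function, where $k(A)$ is the number of connected components of the spanning subgraph $(V,A)$. For $v_0\in\mathbb{C}$ let $\mathcal{B}_q(v_0)\subset\mathbb{C}$ be the accumulation locus, as $m\to\infty$, of the zeros of $q\mapsto Z(D_m,q,v_0)$, that is, the set of $q\in\mathbb{C}$ such that every punctured neighbourhood of $q$ contains a zero of $Z(D_m,\cdot,v_0)$ for infinitely many $m$. Let $-1\le v_0<0$. Then: 1. $\mathcal{B}_q(v_0)$ contains $0$ and $$q_c(v_0)=\left(-2-\sqrt{-v_0}\right)v_0>0.$$ 2. $\mathcal{B}_q(v_0)$ contains no real point outside the interval $[0,q_c(v_0)]$. 3. There is an infinite sequence of pairwise distinct real points $q_k(v_0)\in\mathcal{B}_q(v_0)$ converging to $$q_\infty(v_0)=\begin{cases}\frac{32}{27} & \text{if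 } -1\le v_0\le -\frac{8}{9},\\[2pt] \left(-1-\sqrt{1+v_0}\right)v_0 & \text{if } -\frac{8}{9}\le v_0<0,\end{cases}$$ and $q_\infty(v_0)$ also belongs to $\mathcal{B}_q(v_0)$. In particular, for $v_0=-1$ (the zeros of the chromatic polynomials of the graphs $D_m$), the locus $\mathcal{B}_q(-1)$ contains $0$, $3$ and $\frac{32}{27}$, and a sequence of pairwise distinct real points converging to $\frac{32}{27}$. -/

import Mathlib

open Filter Topology

/-- A finite simple graph, bundled with its vertex type. -/
structure FiniteGraph where
  V : Type
  fintypeV : Fintype V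
  graph : SimpleGraph V

/-- Every edge `e = {a, b}` is removed and replaced by two new vertices `(e, false)` and
`(e, true)` and the four edges joining each of them to `a` and to `b`. -/
def diamondSubdivision {V : Type} (G : SimpleGraph V) :
    SimpleGraph (V ⊕ (G.edgeSet × Bool)) where
  Adj
    | Sum.inl a, Sum.inr (e, _) => a ∈ (e : Sym2 V)
    | Sum.inr (e, _), Sum.inl a => a ∈ (e : Sym2 V)
    | _, _ => False
  symm := ⟨by rintro (a | ⟨e, i⟩) (b | ⟨f, j⟩) h <;> exact h⟩
  loopless := ⟨by rintro (a | ⟨e, i⟩) h <;> exact h⟩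

open Classical in
/-- The diamond hierarchical graph `D_m`: `D_0` is a single edge joining two vertices, and
`D_{m+1}` is obtained from `D_m` by replacing each edge by a diamond. -/
noncomputable def diamondGraph : ℕ → FiniteGraph
  | 0 => ⟨Fin 2, inferInstance, ⊤⟩
  | m + 1 =>
    letI := (diamondGraph m).fintypeV
    ⟨(diamondGraph m).V ⊕ ((diamondGraph m).graph.edgeSet × Bool), inferInstance,
      diamondSubdivision (diamondGraph m).graph⟩

/-- `k(G')` for the spanning subgraph `G' = (V, A)`: its number of connected components. -/
noncomputable def numComponents {V : Type} (A : Set (Sym2 V)) : ℕ :=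
  Nat.card (SimpleGraph.fromEdgeSet A).ConnectedComponent

open Classical in
/-- The Potts model partition function `Z(G, q, v)`, as the sum of `q ^ k(G') * v ^ e(G')` over
all spanning subgraphs `G' = (V, A)`, `A ⊆ E(G)`. -/
noncomputable def pottsZ (G : FiniteGraph) (q v : ℂ) : ℂ :=
  letI := G.fintypeV
  ∑ A ∈ G.graph.edgeFinset.powerset, q ^ numComponents (A : Set (Sym2 G.V)) * v ^ A.card

/-- The locus `B_q(v₀)` of accumulation, as `m → ∞`, of the zeros in the complex `q` plane of
`Z(D_m, q, v₀)`: the points `q` each of whose punctured neighbourhoods contains zeros of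
`Z(D_m, ·, v₀)` for infinitely many `m`. (Isolated zeros, even if common to all `m`, do not
belong to the locus.) -/
def zeroLocus (v₀ : ℂ) : Set ℂ :=
  {q | ∀ ε : ℝ, 0 < ε → ∃ᶠ m : ℕ in atTop, ∃ z : ℂ,
    z ≠ q ∧ dist z q < ε ∧ pottsZ (diamondGraph m) z v₀ = 0}

/-- `q_c(v₀) = (-2 - √(-v₀)) v₀`. -/
noncomputable def qCrit (v₀ : ℝ) : ℝ := (-2 - √(-v₀)) * v₀

/-- `q_∞(v₀)`; the two formulas agree at `v₀ = -8/9`. -/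
noncomputable def qInfty (v₀ : ℝ) : ℝ :=
  if v₀ ≤ -8 / 9 then 32 / 27 else (-1 - √(1 + v₀)) * v₀

/-!
The zeros of the Potts partition functions of the diamond hierarchical graphs accumulate where the
renormalization dynamics changes its behaviour.

Summing over the spins of the new vertices shows that replacing every edge of a graph by a diamond
amounts to replacing the edge weight `v` by `v² (2q + 4v + v²) / (q + 2v)²`; this is
`homPotts_diamondSubdivision`, proved for positive integers `q` by the spin representation and for
all `q` because both sides are polynomials. Hence `Z(D_m, q, v₀) = 0` for `q ≠ 0` if and only if
the transmissivity `u_m = v_m / (v_m + q)` of the renormalized weight `v_m` has a pole.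

The transmissivity `0` is a superattracting fixed point; its basin `N` is the set of `q` for which
`u_m(q) → 0`. Away from `q = 0` it is open and does not meet the locus
(`not_mem_zeroLocus_of_tendsto`).
Conversely, a point `q₀` each of whose punctured neighbourhoods meets `N` and its complement is in
the locus (`mem_zeroLocus_of_frequently`): otherwise the `u_m` are holomorphic on a punctured disc
for large `m`, and since `u_{m+1}` has no pole, `(1 - q)^(1/4) u_m` omits the values `1` and `-1`.
By Schottky's theorem (`schottky`, deduced from Bloch's theorem) such functions are locally bounded
around points of `N`, so that `N` is closed in the punctured disc, which is connected.

It remains to locate points of `N` and of its complement on the real line, in the coordinate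
`X = q / v`, where the renormalization is `X ↦ S² / (2S + q)`, `S = X (X + 2)`, with the fixed
points `X² (X + 2) = q`.
* For `q < 0` and for `q > q_c` the orbit increases to infinity, so that `q ∈ N`; slightly above `0`
  and slightly below `q_c` it stays bounded.
* For `q = q_∞` the orbit of `ξ = -X` stays at or below a fixed point, which is a saddle-node point
  or the repelling starting point, and for `q > q_∞` it escapes through the pole of the
  map (`exists_mem_zeroLocus_of_escape`). As `q` decreases to `q_∞` the escape takes longer and
  longer, and each time the orbit passes both through the pole, where `q ∈ N`, and through `ξ = 2`,
  which leads to the infinite weight, so that `q ∉ N`. In between lies a boundary point of `N`.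
-/

/-! ### Renormalization of the partition function -/

/-- The homogeneous Potts partition function `∑_A q ^ k(A) * a ^ |A| * b ^ (|E| - |A|)`, with
coefficients in a commutative ring; `pottsZ` is the case `b = 1`. -/
noncomputable def homPotts {R : Type*} [CommRing R] {V : Type} [Fintype V] (G : SimpleGraph V)
    (q a b : R) : R :=
  open Classical in
  ∑ A ∈ G.edgeFinset.powerset,
    q ^ numComponents (A : Set (Sym2 V)) * a ^ A.card * b ^ (G.edgeFinset \ A).card

theorem pottsZ_eq_homPotts (G : FiniteGraph) (q v : ℂ) :
    pottsZ G q v = @homPotts ℂ _ G.V G.fintypeV G.graph q v 1 := by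
  simp [pottsZ, homPotts]

theorem map_homPotts {R S : Type*} [CommRing R] [CommRing S] (φ : R →+* S) {V : Type} [Fintype V]
    (G : SimpleGraph V) (q a b : R) :
    φ (homPotts G q a b) = homPotts G (φ q) (φ a) (φ b) := by
  simp [homPotts, map_sum]

/-- Colourings that are constant along the edges in `A` are colourings of the components. -/
theorem card_constant_colorings {V : Type} [Fintype V] (A : Set (Sym2 V)) (n : ℕ) :
    Nat.card {σ : V → Fin n // ∀ e ∈ A, (Sym2.map σ e).IsDiag} = n ^ numComponents A := by
  classical
  have e : {σ : V → Fin n // ∀ e ∈ A, (Sym2.map σ e).IsDiag} ≃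
      ((SimpleGraph.fromEdgeSet A).ConnectedComponent → Fin n) :=
    { toFun := fun σ C => C.lift σ.1 (by
        intro v w p _
        induction p with
        | nil => rfl
        | cons h p ih =>
          rename_i u v w hp
          rw [← ih (by simp_all)]
          have := σ.2 _ ((SimpleGraph.fromEdgeSet_adj A).1 h).1
          simpa using this)
      invFun := fun τ => ⟨fun v => τ ((SimpleGraph.fromEdgeSet A).connectedComponentMk v), by
        intro e
        induction e with
        | _ x y =>
          intro h
          by_cases hxy : x = y
          · simp [hxy]
          · have : (SimpleGraph.fromEdgeSet A).Adj x y :=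
              (SimpleGraph.fromEdgeSet_adj A).2 ⟨h, hxy⟩
            simp [SimpleGraph.ConnectedComponent.sound this.reachable]⟩
      left_inv := fun σ => by ext v; simp
      right_inv := fun τ => by
        ext C
        induction C using SimpleGraph.ConnectedComponent.ind
        simp }
  rw [Nat.card_congr e, Nat.card_fun, Nat.card_fin]
  rfl

/-- The spin representation of the Potts partition function at a positive integer `q = n`. -/
theorem homPotts_natCast {R : Type*} [CommRing R] {V : Type} [Fintype V] [DecidableEq V]
    (G : SimpleGraph V) [DecidableRel G.Adj] (n : ℕ) (a b : R) :
    homPotts G (n : R) a b =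
      ∑ σ : V → Fin n, ∏ e ∈ G.edgeFinset, (b + if (Sym2.map σ e).IsDiag then a else 0) := by
  classical
  have h1 : ∀ A : Finset (Sym2 V), ((n : R) ^ numComponents (A : Set (Sym2 V))) =
      ∑ σ : V → Fin n, ∏ e ∈ A, (if (Sym2.map σ e).IsDiag then (1 : R) else 0) := by
    intro A
    rw [← Nat.cast_pow, ← card_constant_colorings, Nat.card_eq_fintype_card, Fintype.card_subtype]
    rw [Finset.card_filter, Nat.cast_sum]
    refine Finset.sum_congr rfl fun σ _ => ?_
    rw [Finset.prod_ite_zero]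
    simp
  unfold homPotts
  simp_rw [h1, Finset.sum_mul]
  rw [Finset.sum_comm]
  refine Finset.sum_congr rfl fun σ _ => ?_
  simp_rw [add_comm b]
  rw [Finset.prod_add]
  refine Finset.sum_congr (by congr!) fun A _ => ?_
  rw [Finset.prod_const]
  congr 1
  · rw [← Finset.prod_const, ← Finset.prod_mul_distrib]
    refine Finset.prod_congr rfl fun e _ => by simp
  · congr!

/-- The edges of the diamond subdivision: a new vertex together with an end of its edge. -/
theorem prod_edgeFinset_diamondSubdivision {M : Type*} [CommMonoid M] {V : Type} [Fintype V]
    [DecidableEq V] (G : SimpleGraph V) [Fintype G.edgeSet]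
    [Fintype (diamondSubdivision G).edgeSet]
    (w : Sym2 (V ⊕ (G.edgeSet × Bool)) → M) :
    ∏ e ∈ (diamondSubdivision G).edgeFinset, w e =
      ∏ f : G.edgeSet × Bool, ∏ x ∈ (f.1 : Sym2 V).toFinset, w s(Sum.inl x, Sum.inr f) := by
  classical
  rw [Finset.prod_sigma' (s := Finset.univ)
    (t := fun f : G.edgeSet × Bool => (f.1 : Sym2 V).toFinset)]
  symm
  refine Finset.prod_bij (fun p _ => s(Sum.inl p.2, Sum.inr p.1)) ?_ ?_ ?_ ?_
  · rintro ⟨⟨e, i⟩, x⟩ h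
    have hx : x ∈ (e : Sym2 V) := by simpa using h
    exact SimpleGraph.mem_edgeFinset.2 hx
  · rintro ⟨f, x⟩ _ ⟨g, y⟩ _ h
    simp at h
    obtain ⟨rfl, rfl⟩ := h
    rfl
  · intro e
    induction e with
    | _ x y =>
      intro h
      rw [SimpleGraph.mem_edgeFinset, SimpleGraph.mem_edgeSet] at h
      rcases x with x | ⟨e, i⟩ <;> rcases y with y | ⟨f, j⟩
      · exact h.elim
      · exact ⟨⟨⟨f, j⟩, x⟩, by simpa [diamondSubdivision] using h, rfl⟩
      · exact ⟨⟨⟨e, i⟩, y⟩, by simpa [diamondSubdivision] using h, Sym2.eq_swap⟩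
      · exact h.elim
  · intros; rfl

/-- One step of the renormalization of the edge weights, in homogeneous coordinates
`v = p.1 / p.2`: two edges in series followed by two in parallel. -/
def diamondStep {R : Type*} [CommRing R] (q : R) (p : R × R) : R × R :=
  (p.1 ^ 2 * (2 * q * p.2 ^ 2 + 4 * p.1 * p.2 + p.1 ^ 2), (p.2 * (q * p.2 + 2 * p.1)) ^ 2)

theorem homPotts_diamondSubdivision_natCast {R : Type*} [CommRing R] {V : Type} [Fintype V]
    (G : SimpleGraph V) (hF : Fintype (V ⊕ (G.edgeSet × Bool))) (n : ℕ) (a b : R) :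
    homPotts (diamondSubdivision G) (n : R) a b =
      homPotts G (n : R) (diamondStep (n : R) (a, b)).1 (diamondStep (n : R) (a, b)).2 := by
  classical
  rw [homPotts_natCast, homPotts_natCast]
  simp_rw [prod_edgeFinset_diamondSubdivision]
  rw [← (Equiv.sumArrowEquivProdArrow V (G.edgeSet × Bool) (Fin n)).symm.sum_comp,
    Fintype.sum_prod_type]
  refine Finset.sum_congr rfl fun σ _ => ?_
  simp only [Equiv.sumArrowEquivProdArrow_symm_apply_inl,
    Equiv.sumArrowEquivProdArrow_symm_apply_inr, Sym2.map_mk, Sym2.mk_isDiag_iff]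
  rw [← Fintype.prod_sum (fun (f : G.edgeSet × Bool) (t : Fin n) =>
      ∏ x ∈ (f.1 : Sym2 V).toFinset, (b + if σ x = t then a else 0)),
    Fintype.prod_prod_type]
  rw [Finset.prod_subtype (p := (· ∈ G.edgeSet)) G.edgeFinset
    (fun x => SimpleGraph.mem_edgeFinset)]
  refine Finset.prod_congr rfl ?_
  rintro ⟨e, he⟩ -
  induction e with
  | _ x y =>
    have hxy : x ≠ y := G.ne_of_adj he
    have key : ∑ t : Fin n, (b + if σ x = t then a else 0) * (b + if σ y = t then a else 0) =
        n * b ^ 2 + 2 * a * b + if σ x = σ y then a ^ 2 else 0 := by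
      simp only [add_mul, mul_add, Finset.sum_add_distrib, ← Finset.mul_sum, ← Finset.sum_mul]
      simp
      split_ifs <;> ring
    simp [Sym2.toFinset_mk_eq, Finset.prod_pair hxy, key, diamondStep]
    split_ifs <;> ring

/-- Subdividing the graph renormalizes the weights. Both sides are polynomials in `q`, so that it
suffices to compare them at the positive integers. -/
theorem homPotts_diamondSubdivision {V : Type} [Fintype V]
    (G : SimpleGraph V) (hF : Fintype (V ⊕ (G.edgeSet × Bool))) (q a b : ℂ) :
    homPotts (diamondSubdivision G) q a b =
      homPotts G q (diamondStep q (a, b)).1 (diamondStep q (a, b)).2 := by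
  have hev : ∀ x : ℂ, ∀ {W : Type} [Fintype W] (H : SimpleGraph W) (α β : Polynomial ℂ),
      (homPotts H Polynomial.X α β).eval x = homPotts H x (α.eval x) (β.eval x) := by
    intro x W _ H α β
    rw [← Polynomial.coe_evalRingHom, map_homPotts]
    simp
  have hp : homPotts (diamondSubdivision G) Polynomial.X (Polynomial.C a) (Polynomial.C b) =
      homPotts G Polynomial.X
        (diamondStep Polynomial.X (Polynomial.C a, Polynomial.C b)).1
        (diamondStep Polynomial.X (Polynomial.C a, Polynomial.C b)).2 := by
    refine Polynomial.eq_of_infinite_eval_eq _ _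
      (Set.Infinite.mono ?_ (Set.infinite_range_of_injective (Nat.cast_injective (R := ℂ))))
    rintro _ ⟨n, rfl⟩
    have := homPotts_diamondSubdivision_natCast G hF n a b
    simpa [hev, diamondStep, -Polynomial.X_mul_C] using this
  have := congrArg (Polynomial.eval q) hp
  simpa [hev, diamondStep, -Polynomial.X_mul_C] using this

theorem homPotts_edge (hF : Fintype (Fin 2)) (q a b : ℂ) :
    homPotts (⊤ : SimpleGraph (Fin 2)) q a b = q * (a + q * b) := by
  have hn : ∀ n : ℕ, homPotts (⊤ : SimpleGraph (Fin 2)) (n : ℂ) a b = n * (a + n * b) := by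
    intro n
    obtain rfl : hF = Fin.fintype 2 := Subsingleton.elim _ _
    have he : (⊤ : SimpleGraph (Fin 2)).edgeFinset = {s(0, 1)} := by
      ext e
      induction e with
      | _ x y => fin_cases x <;> fin_cases y <;> simp
    rw [homPotts_natCast, he]
    rw [← (finTwoArrowEquiv (Fin n)).symm.sum_comp, Fintype.sum_prod_type]
    simp [Finset.sum_add_distrib]
    ring
  have hp : homPotts (⊤ : SimpleGraph (Fin 2)) Polynomial.X (Polynomial.C a) (Polynomial.C b) =
      Polynomial.X * (Polynomial.C a + Polynomial.X * Polynomial.C b) := by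
    refine Polynomial.eq_of_infinite_eval_eq _ _
      (Set.Infinite.mono ?_ (Set.infinite_range_of_injective (Nat.cast_injective (R := ℂ))))
    rintro _ ⟨n, rfl⟩
    have := map_homPotts (Polynomial.evalRingHom (n : ℂ)) (⊤ : SimpleGraph (Fin 2)) Polynomial.X
      (Polynomial.C a) (Polynomial.C b)
    simp [hn] at this
    simpa [-Polynomial.X_mul_C] using this
  have := map_homPotts (Polynomial.evalRingHom q) (⊤ : SimpleGraph (Fin 2)) Polynomial.X
    (Polynomial.C a) (Polynomial.C b)
  rw [hp] at this
  simpa [-Polynomial.X_mul_C] using this.symm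

/-- The renormalized weight of the edges of `D_m` after `m` steps, in homogeneous coordinates. -/
def weight {R : Type*} [CommRing R] (v q : R) (m : ℕ) : R × R :=
  (diamondStep q)^[m] (v, 1)

/-- `Z(D_m, q, v)` is that of a single edge with the renormalized weight. -/
theorem pottsZ_diamondGraph (m : ℕ) (q v : ℂ) :
    pottsZ (diamondGraph m) q v = q * ((weight v q m).1 + q * (weight v q m).2) := by
  have h : ∀ (m : ℕ) (p : ℂ × ℂ),
      @homPotts ℂ _ (diamondGraph m).V (diamondGraph m).fintypeV (diamondGraph m).graph q p.1 p.2 =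
        q * (((diamondStep q)^[m] p).1 + q * ((diamondStep q)^[m] p).2) := by
    intro m
    induction m with
    | zero => exact fun p => homPotts_edge _ q p.1 p.2
    | succ m ih =>
      intro p
      rw [Function.iterate_succ_apply, ← ih]
      let := (diamondGraph m).fintypeV
      exact homPotts_diamondSubdivision (diamondGraph m).graph _ q p.1 p.2
  rw [pottsZ_eq_homPotts]
  exact h m (v, 1)

/-! ### Theorems of Bloch and Schottky -/

open Metric in
/-- If `f'` varies by at most a factor of two from `f' z` on a disc, then `f` maps the disc onto
a neighbourhood of `f z` of a definite size. -/
theorem ball_subset_image_of_norm_deriv_le {f : ℂ → ℂ} {z : ℂ} {t : ℝ} (ht : 0 < t)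
    (hf : DifferentiableOn ℂ f (ball z t)) (h0 : deriv f z ≠ 0)
    (hb : ∀ w ∈ ball z t, ‖deriv f w‖ ≤ 2 * ‖deriv f z‖) :
    ball (f z) (t * ‖deriv f z‖ / 24) ⊆ f '' ball z t := by
  set α := ‖deriv f z‖ with hα
  have hα0 : 0 < α := norm_pos_iff.2 h0
  have hd : DifferentiableOn ℂ (deriv f) (ball z t) := hf.deriv isOpen_ball
  have hS : ∀ w ∈ ball z t, ‖deriv f w - deriv f z‖ ≤ 3 * α / t * ‖w - z‖ := by
    intro w hw
    have := Complex.dist_le_div_mul_dist_of_mapsTo_ball (R₂ := 3 * α) hd (fun x hx => by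
      rw [mem_closedBall, dist_eq_norm]
      calc _ ≤ ‖deriv f x‖ + ‖deriv f z‖ := norm_sub_le _ _
        _ ≤ 2 * α + α := add_le_add (hb x hx) le_rfl
        _ = _ := by ring) hw
    simpa [dist_eq_norm] using this
  have hsub : closedBall z (t / 6) ⊆ ball z t := closedBall_subset_ball (by linarith)
  have hlin : ∀ w ∈ closedBall z (t / 6),
      ‖(f w - deriv f z * w) - (f z - deriv f z * z)‖ ≤ α / 2 * ‖w - z‖ := by
    intro w hw
    refine (convex_closedBall z (t / 6)).norm_image_sub_le_of_norm_hasDerivWithin_le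
      (f := fun w => f w - deriv f z * w) (f' := fun w => deriv f w - deriv f z)
      (fun x hx => ?_) (fun x hx => ?_) (mem_closedBall_self (by linarith)) hw
    · have h1 := (hf.differentiableAt (isOpen_ball.mem_nhds (hsub hx))).hasDerivAt
      have h2 := (hasDerivAt_id x).const_mul (deriv f z)
      rw [mul_one] at h2
      exact (h1.sub h2).hasDerivWithinAt
    · refine (hS x (hsub hx)).trans ?_
      rw [mem_closedBall, dist_eq_norm] at hx
      calc 3 * α / t * ‖x - z‖ ≤ 3 * α / t * (t / 6) := by gcongr
        _ = α / 2 := by field_simp; norm_num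
  have hsph : ∀ w ∈ sphere z (t / 6), t * α / 12 ≤ ‖f w - f z‖ := by
    intro w hw
    have h1 := hlin w (sphere_subset_closedBall hw)
    rw [mem_sphere, dist_eq_norm] at hw
    have h2 : deriv f z * (w - z) =
      (f w - f z) - ((f w - deriv f z * w) - (f z - deriv f z * z)) := by ring
    have h3 : α * ‖w - z‖ ≤ ‖f w - f z‖ + α / 2 * ‖w - z‖ := by
      rw [hα, ← norm_mul, h2]
      exact (norm_sub_le _ _).trans (add_le_add le_rfl h1)
    rw [hw] at h3
    linarith
  have hne : ∃ᶠ w in 𝓝 z, f w ≠ f z := by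
    have := (hf.differentiableAt (isOpen_ball.mem_nhds (mem_ball_self ht))).hasDerivAt
    exact (this.eventually_ne h0).frequently.filter_mono nhdsWithin_le_nhds
  have := DiffContOnCl.ball_subset_image_closedBall (f := f) (r := t / 6)
    ((hf.mono hsub).diffContOnCl_ball subset_rfl) (by linarith) hsph hne
  refine Set.Subset.trans ?_ (this.trans (Set.image_mono hsub))
  exact ball_subset_ball (by linarith)

open Metric in
/-- **Bloch's theorem**, with a crude constant: a holomorphic function on a disc of radius `R`
whose image contains no disc of radius `ρ` has derivative at most `48 ρ / R` at the centre. -/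
theorem norm_deriv_le_of_not_ball_subset {f : ℂ → ℂ} {c : ℂ} {R ρ : ℝ}
    (hf : DifferentiableOn ℂ f (ball c R))
    (hρ : ∀ w, ¬ ball w ρ ⊆ f '' ball c R) {r : ℝ} (hr : 0 < r) (hrR : r < R) :
    r * ‖deriv f c‖ ≤ 48 * ρ := by
  by_contra! hlt
  have hsub : closedBall c r ⊆ ball c R := closedBall_subset_ball hrR
  have hd : ContinuousOn (deriv f) (closedBall c r) :=
    ((hf.deriv isOpen_ball).continuousOn).mono hsub
  -- maximize the derivative weighted by the distance to the boundary
  obtain ⟨p, hp, hmax⟩ := (isCompact_closedBall c r).exists_isMaxOn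
    (f := fun z => (r - ‖z - c‖) * ‖deriv f z‖) ⟨c, mem_closedBall_self hr.le⟩
    (by fun_prop)
  have hρ0 : 0 ≤ ρ := by
    by_contra! h
    exact hρ 0 (by simp [ball_eq_empty.2 h.le])
  have hM : r * ‖deriv f c‖ ≤ (r - ‖p - c‖) * ‖deriv f p‖ := by
    simpa using hmax (mem_closedBall_self hr.le)
  have hpos : 0 < (r - ‖p - c‖) * ‖deriv f p‖ := by linarith
  have hpr : 0 < r - ‖p - c‖ := by
    by_contra! h
    nlinarith [norm_nonneg (deriv f p)]
  have hdp : 0 < ‖deriv f p‖ := by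
    by_contra! h
    nlinarith
  set t := (r - ‖p - c‖) / 2 with ht
  have hin : ∀ w ∈ ball p t, t ≤ r - ‖w - c‖ := by
    intro w hw
    rw [mem_ball, dist_eq_norm] at hw
    have : ‖w - c‖ ≤ ‖w - p‖ + ‖p - c‖ := norm_sub_le_norm_sub_add_norm_sub _ _ _
    linarith
  have hball : ball p t ⊆ closedBall c r := fun w hw => by
    rw [mem_closedBall, dist_eq_norm]
    linarith [hin w hw]
  have ht0 : 0 < t := by linarith
  have := ball_subset_image_of_norm_deriv_le (f := f) ht0 (hf.mono (hball.trans hsub))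
    (norm_pos_iff.1 hdp) (fun w hw => by
      have h1 : (r - ‖w - c‖) * ‖deriv f w‖ ≤ (r - ‖p - c‖) * ‖deriv f p‖ := hmax (hball hw)
      have h2 : t * ‖deriv f w‖ ≤ t * (2 * ‖deriv f p‖) := by
        calc t * ‖deriv f w‖ ≤ (r - ‖w - c‖) * ‖deriv f w‖ := by
              gcongr; exact hin w hw
          _ ≤ _ := h1
          _ = _ := by rw [ht]; ring
      exact le_of_mul_le_mul_left h2 ht0)
  refine hρ (f p) (Set.Subset.trans (ball_subset_ball ?_)
    (this.trans (Set.image_mono (hball.trans hsub))))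
  have : (r - ‖p - c‖) * ‖deriv f p‖ = 2 * (t * ‖deriv f p‖) := by rw [ht]; ring
  linarith

open Metric in
/-- A nowhere vanishing holomorphic function on a disc has a holomorphic logarithm. -/
theorem exists_differentiableOn_exp_eq {g : ℂ → ℂ} {c : ℂ} {r : ℝ}
    (hg : DifferentiableOn ℂ g (ball c r)) (h0 : ∀ z ∈ ball c r, g z ≠ 0) :
    ∃ f : ℂ → ℂ, DifferentiableOn ℂ f (ball c r) ∧ ∀ z ∈ ball c r, Complex.exp (f z) = g z := by
  rcases le_or_gt r 0 with hr | hr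
  · exact ⟨0, by simp [ball_eq_empty.2 hr]⟩
  have hd : DifferentiableOn ℂ (fun z => deriv g z / g z) (ball c r) :=
    (hg.deriv isOpen_ball).div hg h0
  obtain ⟨f, hfc, hf⟩ := hd.isExactOn_ball.with_val_at c (Complex.log (g c))
  have hfd : DifferentiableOn ℂ f (ball c r) :=
    fun z hz => (hf z hz).differentiableAt.differentiableWithinAt
  refine ⟨f, hfd, ?_⟩
  have hder : ∀ z ∈ ball c r, HasDerivAt (fun z => g z * Complex.exp (-f z)) 0 z := by
    intro z hz
    have h1 := (hg.differentiableAt (isOpen_ball.mem_nhds hz)).hasDerivAt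
    have h2 := (hf z hz).neg.cexp
    have h3 : deriv g z * Complex.exp (-f z) +
        g z * (Complex.exp (-f z) * -(deriv g z / g z)) = 0 := by
      have := h0 z hz
      field_simp
      ring
    exact h3 ▸ h1.mul h2
  intro z hz
  have hcst := (convex_ball c r).is_const_of_fderivWithin_eq_zero (𝕜 := ℂ)
    (f := fun z => g z * Complex.exp (-f z))
    (fun x hx => (hder x hx).differentiableAt.differentiableWithinAt)
    (fun x hx => by
      rw [fderivWithin_of_isOpen isOpen_ball hx]
      ext
      rw [(hder x hx).hasFDerivAt.fderiv]
      simp)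
    hz (mem_ball_self hr)
  simp only [hfc, Complex.exp_neg, Complex.exp_log (h0 c (mem_ball_self hr)),
    mul_inv_cancel₀ (h0 c (mem_ball_self hr))] at hcst
  field_simp at hcst
  exact hcst.symm

/-- The modulus of the cosine controls the imaginary part of the argument. -/
theorem norm_le_of_cos_eq {x y : ℂ} (h : Complex.cos x = y) (hre : |x.re| ≤ Real.pi) :
    ‖x‖ ≤ Real.pi + ‖y‖ := by
  have h1 : |x.im| ≤ ‖y‖ := by
    rw [← h]
    have hn : ‖Complex.cos x‖ ^ 2 = Real.cos x.re ^ 2 + Real.sinh x.im ^ 2 := by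
      rw [← Complex.normSq_eq_norm_sq, Complex.normSq_apply, Complex.cos_eq]
      simp [← Complex.ofReal_cos, ← Complex.ofReal_sin, ← Complex.ofReal_cosh,
        ← Complex.ofReal_sinh]
      have := Real.cosh_sq x.im
      have := Real.sin_sq_add_cos_sq x.re
      nlinarith
    have h2 : |Real.sinh x.im| ≤ ‖Complex.cos x‖ := by
      apply abs_le_of_sq_le_sq _ (norm_nonneg _)
      nlinarith [sq_nonneg (Real.cos x.re)]
    refine le_trans ?_ h2
    rw [Real.abs_sinh]
    exact Real.self_le_sinh_iff.2 (abs_nonneg _)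
  exact (Complex.norm_le_abs_re_add_abs_im x).trans (add_le_add hre h1)

open Metric in
/-- A holomorphic function on a disc omitting `1` and `-1` is the cosine of a holomorphic
function, whose value at the centre can be chosen of bounded real part. -/
theorem exists_cos_eq {f : ℂ → ℂ} {c : ℂ} {r : ℝ} (hr : 0 < r)
    (hf : DifferentiableOn ℂ f (ball c r))
    (h1 : ∀ z ∈ ball c r, f z ≠ 1) (h2 : ∀ z ∈ ball c r, f z ≠ -1) :
    ∃ F : ℂ → ℂ, DifferentiableOn ℂ F (ball c r) ∧ (∀ z ∈ ball c r, Complex.cos (F z) = f z) ∧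
      ‖F c‖ ≤ Real.pi + ‖f c‖ := by
  obtain ⟨l, hl, hle⟩ := exists_differentiableOn_exp_eq (g := fun z => f z ^ 2 - 1)
    ((hf.pow 2).sub_const 1) (fun z hz h => by
      have : (f z - 1) * (f z + 1) = 0 := by linear_combination h
      rcases mul_eq_zero.1 this with h | h
      · exact h1 z hz (by linear_combination h)
      · exact h2 z hz (by linear_combination h))
  have hs : ∀ z ∈ ball c r, Complex.exp (l z / 2) ^ 2 = f z ^ 2 - 1 := by
    intro z hz
    rw [← hle z hz, ← Complex.exp_nat_mul]
    congr 1
    push_cast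
    ring
  have hprod : ∀ z ∈ ball c r,
      (f z + Complex.exp (l z / 2)) * (f z - Complex.exp (l z / 2)) = 1 := by
    intro z hz
    linear_combination - hs z hz
  -- `f + √(f² - 1) = exp L` and its inverse `f - √(f² - 1)` have mean `f`
  obtain ⟨L, hL, hLe⟩ := exists_differentiableOn_exp_eq
    (g := fun z => f z + Complex.exp (l z / 2)) (hf.add ((hl.div_const 2).cexp))
    (fun z hz h => by
      have := hprod z hz
      rw [h] at this
      simp at this)
  -- shift by a multiple of `2π` to normalize the value at the centre
  obtain ⟨k, hk⟩ : ∃ k : ℤ, |(L c / Complex.I).re - k * (2 * Real.pi)| ≤ Real.pi := by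
    refine ⟨round ((L c / Complex.I).re / (2 * Real.pi)), ?_⟩
    have := abs_sub_round ((L c / Complex.I).re / (2 * Real.pi))
    have hpi := Real.pi_pos
    have h3 : (L c / Complex.I).re - round ((L c / Complex.I).re / (2 * Real.pi)) * (2 * Real.pi)
        = ((L c / Complex.I).re / (2 * Real.pi) - round ((L c / Complex.I).re / (2 * Real.pi)))
          * (2 * Real.pi) := by field_simp
    rw [h3, abs_mul, abs_of_pos (by positivity : (0:ℝ) < 2 * Real.pi)]
    nlinarith
  have hcos : ∀ z ∈ ball c r, Complex.cos (L z / Complex.I - k * (2 * Real.pi)) = f z := by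
    intro z hz
    rw [Complex.cos_sub_int_mul_two_pi, Complex.cos]
    have e1 : L z / Complex.I * Complex.I = L z := by field_simp
    have e2 : -(L z / Complex.I) * Complex.I = -L z := by field_simp
    rw [e1, e2, Complex.exp_neg, hLe z hz]
    have h3 : (f z + Complex.exp (l z / 2))⁻¹ = f z - Complex.exp (l z / 2) :=
      inv_eq_of_mul_eq_one_right (hprod z hz)
    rw [h3]
    ring
  refine ⟨fun z => L z / Complex.I - k * (2 * Real.pi), ?_, hcos, ?_⟩
  · exact (hL.div_const _).sub_const _
  · refine norm_le_of_cos_eq (hcos c (mem_ball_self hr)) ?_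
    convert hk using 2
    simp

/-- The points where the cosine is an integer are relatively dense in the plane. -/
theorem exists_cos_eq_intCast (w : ℂ) :
    ∃ h : ℂ, ‖h - w‖ < 10 ∧ ∃ n : ℤ, Complex.cos h = n := by
  have hcosh : ∀ t : ℝ, 0 ≤ t → ∃ s, |s - t| ≤ 2 ∧ ∃ n : ℤ, Real.cosh s = n := by
    intro t ht
    have h1 : Real.cosh t + 1 ≤ Real.cosh (t + 2) := by
      rw [Real.cosh_add]
      have a1 := Real.one_le_cosh t
      have a2 : 0 ≤ Real.sinh t := Real.sinh_nonneg_iff.2 ht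
      have a3 : 2 ≤ Real.sinh 2 := Real.self_le_sinh_iff.2 (by norm_num)
      have a4 : 2 ≤ Real.cosh 2 := a3.trans (Real.sinh_lt_cosh 2).le
      nlinarith
    have h2 : ((⌈Real.cosh t⌉ : ℤ) : ℝ) ∈ Set.Icc (Real.cosh t) (Real.cosh (t + 2)) :=
      ⟨Int.le_ceil _, (Int.ceil_lt_add_one _).le.trans h1⟩
    obtain ⟨s, hs, hs'⟩ := intermediate_value_Icc (by linarith : t ≤ t + 2)
      Real.continuous_cosh.continuousOn h2
    exact ⟨s, by rw [abs_le]; constructor <;> linarith [hs.1, hs.2], _, hs'⟩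
  obtain ⟨s, hs, n, hn⟩ : ∃ s, |s - w.im| ≤ 2 ∧ ∃ n : ℤ, Real.cosh s = n := by
    rcases le_total 0 w.im with h | h
    · exact hcosh _ h
    · obtain ⟨s, hs, n, hn⟩ := hcosh (-w.im) (by linarith)
      exact ⟨-s, by rw [← abs_neg]; convert hs using 2; ring, n, by rwa [Real.cosh_neg]⟩
  set k := round (w.re / (2 * Real.pi)) with hk
  have hpi := Real.pi_pos
  have hre : |k * (2 * Real.pi) - w.re| ≤ Real.pi := by
    have := abs_sub_round (w.re / (2 * Real.pi))
    have h3 : w.re - k * (2 * Real.pi) = (w.re / (2 * Real.pi) - k) * (2 * Real.pi) := by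
      field_simp
    rw [abs_sub_comm, h3, abs_mul, abs_of_pos (by positivity : (0:ℝ) < 2 * Real.pi)]
    nlinarith
  refine ⟨s * Complex.I + k * (2 * Real.pi), ?_, n, ?_⟩
  · refine (Complex.norm_le_abs_re_add_abs_im _).trans_lt ?_
    simp only [Complex.sub_re, Complex.add_re, Complex.sub_im, Complex.add_im]
    simp
    have : Real.pi < 4 := Real.pi_lt_four
    linarith
  · rw [Complex.cos_add_int_mul_two_pi, Complex.cos_mul_I, ← Complex.ofReal_cosh, hn]
    simp

open Metric in
/-- **Schottky's theorem**: holomorphic functions on a disc that omit `1` and `-1` and are bounded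
by `R` at the centre are uniformly bounded on the disc of half the radius. -/
theorem schottky (R : ℝ) : ∃ C : ℝ, ∀ (f : ℂ → ℂ) (c : ℂ) (r : ℝ), 0 < r →
    DifferentiableOn ℂ f (ball c r) → (∀ z ∈ ball c r, f z ≠ 1) → (∀ z ∈ ball c r, f z ≠ -1) →
    ‖f c‖ ≤ R → ∀ z ∈ ball c (r / 2), ‖f z‖ ≤ C := by
  -- `f = cos (π cos H)`, where `H` is bounded by `π + (π + R)` at the centre and has bounded slope
  set B : ℝ := Real.pi + (Real.pi + R) + 2000 with hB
  obtain ⟨C, hC⟩ := (isCompact_closedBall (0 : ℂ) B).exists_bound_of_continuousOn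
    (f := fun h => Complex.cos (Real.pi * Complex.cos h)) (by fun_prop)
  refine ⟨C, fun f c r hr hf h1 hm1 hR z hz => ?_⟩
  obtain ⟨F, hF, hFf, hFc⟩ := exists_cos_eq hr hf h1 hm1
  have hpi : (Real.pi : ℂ) ≠ 0 := by exact_mod_cast Real.pi_ne_zero
  obtain ⟨H, hH, hHF, hHc⟩ := exists_cos_eq (f := fun z => F z / Real.pi) hr (hF.div_const _)
    (fun w hw h => by
      have : F w = Real.pi := by field_simp at h; exact h
      exact hm1 w hw (by rw [← hFf w hw, this, Complex.cos_pi]))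
    (fun w hw h => by
      have : F w = -Real.pi := by field_simp at h; exact h
      exact hm1 w hw (by rw [← hFf w hw, this, Complex.cos_neg, Complex.cos_pi]))
  have hfH : ∀ w ∈ ball c r, f w = Complex.cos (Real.pi * Complex.cos (H w)) := by
    intro w hw
    rw [hHF w hw, ← hFf w hw]
    congr 1
    field_simp
  have homit : ∀ w ∈ ball c r, ∀ n : ℤ, Complex.cos (H w) ≠ n := by
    intro w hw n h
    have h3 := hfH w hw
    rw [h, mul_comm] at h3
    have h4 : f w ^ 2 = 1 := by
      have := Complex.sin_sq_add_cos_sq ((n : ℂ) * Real.pi)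
      rw [Complex.sin_int_mul_pi, ← h3] at this
      simpa using this
    rcases sq_eq_one_iff.1 h4 with h5 | h5
    · exact h1 w hw h5
    · exact hm1 w hw h5
  -- every disc of radius `10` contains an omitted value of `H`, so Bloch's theorem applies
  have hder : ∀ w ∈ ball c (r / 2), ‖deriv H w‖ ≤ 48 * 10 / (r / 4) := by
    intro w hw
    have hsub : ball w (r / 2) ⊆ ball c r := by
      refine ball_subset_ball' ?_
      rw [mem_ball] at hw
      linarith
    have := norm_deriv_le_of_not_ball_subset (ρ := 10) (hH.mono hsub) (fun y hy => by
      obtain ⟨h, hh, n, hn⟩ := exists_cos_eq_intCast y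
      obtain ⟨x, hx, rfl⟩ := hy (by rwa [mem_ball, dist_eq_norm] : h ∈ ball y 10)
      exact homit x (hsub hx) n hn) (r := r / 4) (by linarith) (by linarith)
    rw [le_div_iff₀ (by linarith)]
    linarith
  have hdiff : ‖H z - H c‖ ≤ 48 * 10 / (r / 4) * ‖z - c‖ := by
    refine (convex_ball c (r / 2)).norm_image_sub_le_of_norm_deriv_le
      (fun x hx => hH.differentiableAt (isOpen_ball.mem_nhds
        (ball_subset_ball (by linarith) hx))) hder (mem_ball_self (by linarith)) hz
  have hHz : H z ∈ closedBall (0 : ℂ) B := by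
    rw [mem_closedBall_zero_iff]
    have h5 : ‖z - c‖ ≤ r / 2 := by
      rw [mem_ball, dist_eq_norm] at hz
      exact hz.le
    have h6 : 48 * 10 / (r / 4) * ‖z - c‖ ≤ 48 * 10 / (r / 4) * (r / 2) := by gcongr
    have h7 : 48 * 10 / (r / 4) * (r / 2) = 960 := by field_simp; norm_num
    have h8 : ‖F c / Real.pi‖ ≤ Real.pi + R := by
      rw [norm_div, Complex.norm_real, Real.norm_eq_abs, abs_of_pos Real.pi_pos]
      refine (div_le_self (norm_nonneg _) (by linarith [Real.pi_gt_three])).trans ?_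
      linarith
    have h9 : ‖H z‖ ≤ ‖H c‖ + ‖H z - H c‖ := by
      simpa using norm_add_le (H c) (H z - H c)
    linarith
  rw [hfH z (ball_subset_ball (by linarith) hz)]
  exact hC _ hHz

/-! ### The basin of transmissivity zero -/

open Metric in
/-- A bounded sequence of holomorphic functions on a disc that tends to `0` uniformly near the
centre tends to `0` everywhere: the Taylor coefficients tend to `0` and are dominated. -/
theorem tendsto_zero_of_tendsto_zero_near {f : ℕ → ℂ → ℂ} {a : ℂ} {R δ C : ℝ} {e : ℕ → ℝ}
    (hf : ∀ m, DifferentiableOn ℂ (f m) (ball a R)) (hC : ∀ m, ∀ z ∈ ball a R, ‖f m z‖ ≤ C)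
    (hδ : 0 < δ) (hδR : δ < R) (he : Tendsto e atTop (𝓝 0))
    (hfe : ∀ m, ∀ z ∈ closedBall a δ, ‖f m z‖ ≤ e m) {z : ℂ} (hz : z ∈ ball a R) :
    Tendsto (fun m => f m z) atTop (𝓝 0) := by
  have hsum : ∀ m, HasSum (fun n : ℕ => (n.factorial : ℂ)⁻¹ • (z - a) ^ n •
      iteratedDeriv n (f m) a) (f m z) := fun m => Complex.hasSum_taylorSeries_on_ball (hf m) hz
  rw [mem_ball, dist_eq_norm] at hz
  obtain ⟨ρ, hρ, hρR⟩ := exists_between hz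
  have hρ0 : 0 < ρ := (norm_nonneg _).trans_lt hρ
  have hcauchy : ∀ (m n : ℕ) (s K : ℝ), 0 < s → s < R → (∀ w ∈ sphere a s, ‖f m w‖ ≤ K) →
      ‖(n.factorial : ℂ)⁻¹ • (z - a) ^ n • iteratedDeriv n (f m) a‖ ≤ K * (‖z - a‖ / s) ^ n := by
    intro m n s K hs hsR hK
    have := Complex.norm_iteratedDeriv_le_of_forall_mem_sphere_norm_le n hs
      (((hf m).mono (closedBall_subset_ball hsR)).diffContOnCl_ball subset_rfl) hK
    rw [norm_smul, norm_smul, norm_inv, norm_pow, Complex.norm_natCast]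
    have hn : (0 : ℝ) < n.factorial := by exact_mod_cast n.factorial_pos
    calc _ ≤ (n.factorial : ℝ)⁻¹ * (‖z - a‖ ^ n * (n.factorial * K / s ^ n)) := by gcongr
      _ = _ := by rw [div_pow]; field_simp
  have hlim : Tendsto (fun m => ∑' n : ℕ, (n.factorial : ℂ)⁻¹ • (z - a) ^ n •
      iteratedDeriv n (f m) a) atTop (𝓝 (∑' _ : ℕ, (0 : ℂ))) := by
    refine tendsto_tsum_of_dominated_convergence (bound := fun n => C * (‖z - a‖ / ρ) ^ n)
      ((summable_geometric_of_lt_one (by positivity) ((div_lt_one hρ0).2 hρ)).mul_left C) ?_ ?_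
    · intro n
      refine squeeze_zero_norm (fun m => hcauchy m n δ (e m) hδ hδR
        fun w hw => hfe m w (sphere_subset_closedBall hw)) ?_
      simpa using he.mul_const ((‖z - a‖ / δ) ^ n)
    · exact Eventually.of_forall fun m n => hcauchy m n ρ C hρ0 hρR
        fun w hw => hC m w (closedBall_subset_ball hρR (sphere_subset_closedBall hw))
  simp_rw [(hsum _).tsum_eq, tsum_zero] at hlim
  exact hlim

theorem weight_succ {R : Type*} [CommRing R] (v q : R) (m : ℕ) :
    weight v q (m + 1) = diamondStep q (weight v q m) := by
  rw [weight, Function.iterate_succ_apply', ← weight]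

/-- The transmissivity `v / (v + q)` of the renormalized weight of the edges of `D_m`. The zeros of
the partition function are its poles. -/
noncomputable def transmissivity {K : Type*} [Field K] (v q : K) (m : ℕ) : K :=
  (weight v q m).1 / ((weight v q m).1 + q * (weight v q m).2)

theorem differentiable_weight (v : ℂ) (m : ℕ) :
    Differentiable ℂ (fun q => (weight v q m).1) ∧
      Differentiable ℂ (fun q => (weight v q m).2) := by
  induction m with
  | zero => simp [weight]
  | succ m ih =>
    obtain ⟨h1, h2⟩ := ih
    simp only [weight_succ, diamondStep]
    constructor <;> fun_prop

/-- With `p.1 / p.2` the weight, the denominator of the transmissivity is renormalized by the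
factor `1 + (q - 1) * u ^ 4`, up to a power and `q`, where `u` is the transmissivity before the
step: the fourth roots of `1 / (1 - q)` are the preimages of the pole. -/
theorem mul_denom_diamondStep {K : Type*} [Field K] {q : K} {p : K × K}
    (hp : p.1 + q * p.2 ≠ 0) :
    q * ((diamondStep q p).1 + q * (diamondStep q p).2) =
      (p.1 + q * p.2) ^ 4 * (1 + (q - 1) * (p.1 / (p.1 + q * p.2)) ^ 4) := by
  field_simp
  simp only [diamondStep]
  ring

theorem transmissivity_diamondStep {K : Type*} [Field K] {q : K} (hq : q ≠ 0) {p : K × K}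
    (hp : p.1 + q * p.2 ≠ 0) :
    (diamondStep q p).1 / ((diamondStep q p).1 + q * (diamondStep q p).2) =
      (p.1 / (p.1 + q * p.2)) ^ 2 * (2 + (q - 2) * (p.1 / (p.1 + q * p.2)) ^ 2) /
        (1 + (q - 1) * (p.1 / (p.1 + q * p.2)) ^ 4) := by
  have h1 : q * (diamondStep q p).1 = (p.1 + q * p.2) ^ 4 *
      ((p.1 / (p.1 + q * p.2)) ^ 2 * (2 + (q - 2) * (p.1 / (p.1 + q * p.2)) ^ 2)) := by
    field_simp
    simp only [diamondStep]
    ring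
  rw [← mul_div_mul_left _ _ hq, h1, mul_denom_diamondStep hp,
    mul_div_mul_left _ _ (pow_ne_zero 4 hp)]

/-- Transmissivity `0` is superattracting, uniformly for bounded `q`. -/
theorem exists_trap (Q : ℝ) (hQ : 0 ≤ Q) : ∃ η > 0, ∀ q : ℂ, q ≠ 0 → ‖q‖ ≤ Q → ∀ (v : ℂ) (m : ℕ),
    (weight v q m).1 + q * (weight v q m).2 ≠ 0 → ‖transmissivity v q m‖ ≤ η →
    ∀ k, (weight v q (m + k)).1 + q * (weight v q (m + k)).2 ≠ 0 ∧
      ‖transmissivity v q (m + k)‖ ≤ η * (1 / 2) ^ k := by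
  refine ⟨1 / (8 * (Q + 2)), by positivity, fun q hq hqQ v m hp hu k => ?_⟩
  set η := 1 / (8 * (Q + 2)) with hη
  have hη0 : 0 < η := by positivity
  have hηQ : η * (Q + 2) = 1 / 8 := by rw [hη]; field_simp
  have hη1 : η ≤ 1 / 16 := by nlinarith
  induction k with
  | zero => simpa using ⟨hp, hu⟩
  | succ k ih =>
    obtain ⟨hp, hu⟩ := ih
    rw [← add_assoc]
    unfold transmissivity at hu ⊢
    rw [weight_succ]
    set p := weight v q (m + k)
    have hstep := transmissivity_diamondStep hq hp
    have hden := mul_denom_diamondStep hp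
    set u := p.1 / (p.1 + q * p.2)
    have hu1 : ‖u‖ ≤ η := hu.trans (mul_le_of_le_one_right hη0.le (by
      exact pow_le_one₀ (by norm_num) (by norm_num)))
    have hu0 := norm_nonneg u
    have h2 : ‖(q - 2) * u ^ 2‖ ≤ 1 / 2 := by
      rw [norm_mul, norm_pow]
      have : ‖q - 2‖ ≤ Q + 2 := (norm_sub_le _ _).trans (by simpa using hqQ)
      calc ‖q - 2‖ * ‖u‖ ^ 2 ≤ (Q + 2) * η ^ 2 := by gcongr
        _ ≤ 1 / 2 := by nlinarith
    have h1 : ‖(q - 1) * u ^ 4‖ ≤ 1 / 2 := by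
      rw [norm_mul, norm_pow]
      have : ‖q - 1‖ ≤ Q + 2 := (norm_sub_le _ _).trans (by
        rw [norm_one]; linarith)
      calc ‖q - 1‖ * ‖u‖ ^ 4 ≤ (Q + 2) * η ^ 4 := by gcongr
        _ = (η * (Q + 2)) * η ^ 3 := by ring
        _ ≤ 1 / 8 * 1 ^ 3 := by rw [hηQ]; gcongr; linarith
        _ ≤ 1 / 2 := by norm_num
    have h3 : 1 / 2 ≤ ‖1 + (q - 1) * u ^ 4‖ := by
      have := norm_sub_le (1 + (q - 1) * u ^ 4) ((q - 1) * u ^ 4)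
      rw [add_sub_cancel_right, norm_one] at this
      linarith
    have h3' : 1 + (q - 1) * u ^ 4 ≠ 0 := by
      intro h
      rw [h] at h3
      norm_num at h3
    refine ⟨fun h => ?_, ?_⟩
    · rw [h, mul_zero] at hden
      exact mul_ne_zero (pow_ne_zero 4 hp) h3' hden.symm
    · rw [hstep, norm_div, norm_mul, norm_pow, div_le_iff₀ (by linarith)]
      have h4 : ‖2 + (q - 2) * u ^ 2‖ ≤ 5 / 2 := by
        refine (norm_add_le _ _).trans ?_
        rw [show ‖(2 : ℂ)‖ = 2 by simp]
        linarith
      have hk : (0 : ℝ) < (1 / 2) ^ k := by positivity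
      calc ‖u‖ ^ 2 * ‖2 + (q - 2) * u ^ 2‖ ≤ (η * (η * (1 / 2) ^ k)) * (5 / 2) := by
            rw [sq]; gcongr
        _ ≤ η * (1 / 2) ^ (k + 1) * (1 / 2) := by
            rw [pow_succ]
            have : 0 < η * (1 / 2) ^ k := by positivity
            nlinarith
        _ ≤ _ := by gcongr

theorem pottsZ_diamondGraph_ne_zero_iff {m : ℕ} {q v : ℂ} (hq : q ≠ 0) :
    pottsZ (diamondGraph m) q v ≠ 0 ↔ (weight v q m).1 + q * (weight v q m).2 ≠ 0 := by
  simp [pottsZ_diamondGraph, hq]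

open Metric in
/-- The basin of `0` is open, and the convergence in it is locally uniform. -/
theorem exists_ball_transmissivity_le {v q : ℂ} (hq : q ≠ 0) {m : ℕ}
    (hP : ∃ᶠ m in atTop, (weight v q m).1 + q * (weight v q m).2 ≠ 0)
    (h : Tendsto (transmissivity v q) atTop (𝓝 0)) :
    ∃ δ > 0, ∃ η : ℝ, ∃ n ≥ m, ∀ z ∈ ball q δ, ∀ k,
      (weight v z (n + k)).1 + z * (weight v z (n + k)).2 ≠ 0 ∧
      ‖transmissivity v z (n + k)‖ ≤ η * (1 / 2) ^ k := by
  obtain ⟨η, hη, htrap⟩ := exists_trap (‖q‖ + 1) (by positivity)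
  have h1 : ∀ᶠ m in atTop, ‖transmissivity v q m‖ < η := by
    simpa using h.norm.eventually_lt_const (by simpa using hη)
  obtain ⟨n, hn, hnm, hnu⟩ := (hP.and_eventually ((eventually_ge_atTop m).and h1)).exists
  have hA := (differentiable_weight v n).1.continuous
  have hB := (differentiable_weight v n).2.continuous
  have e1 : ∀ᶠ z in 𝓝 q, (weight v z n).1 + z * (weight v z n).2 ≠ 0 :=
    (hA.add (continuous_id.mul hB)).continuousAt.eventually_ne hn
  have e2 : ∀ᶠ z in 𝓝 q, ‖transmissivity v z n‖ < η :=
    ((hA.continuousAt.div (hA.add (continuous_id.mul hB)).continuousAt hn).norm).eventually_lt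
      continuousAt_const hnu
  have e3 : ∀ᶠ z in 𝓝 q, ‖z‖ < ‖q‖ + 1 :=
    continuous_norm.continuousAt.eventually_lt continuousAt_const (by simp)
  obtain ⟨δ, hδ, hδ'⟩ := Metric.eventually_nhds_iff_ball.1
    (((e1.and e2).and e3).and (eventually_ne_nhds hq))
  refine ⟨δ, hδ, η, n, hnm, fun z hz => ?_⟩
  obtain ⟨⟨⟨z1, z2⟩, z3⟩, z4⟩ := hδ' z hz
  exact htrap z z4 z3.le v n z1 z2.le

/-- In the basin of `0` the partition functions eventually do not vanish. The condition on the
denominators excludes that the transmissivities are only `0` by the convention `x / 0 = 0`. -/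
theorem not_mem_zeroLocus_of_tendsto {v q : ℂ} (hq : q ≠ 0)
    (hP : ∃ᶠ m in atTop, (weight v q m).1 + q * (weight v q m).2 ≠ 0)
    (h : Tendsto (transmissivity v q) atTop (𝓝 0)) : q ∉ zeroLocus v := by
  obtain ⟨δ, hδ, η, n, -, hn⟩ := exists_ball_transmissivity_le (m := 0) hq hP h
  intro hmem
  have hpos : 0 < ‖q‖ := norm_pos_iff.2 hq
  obtain ⟨m, ⟨z, hz, hzd, hz0⟩, hm⟩ :=
    ((hmem (min δ ‖q‖) (lt_min hδ hpos)).and_eventually (eventually_ge_atTop n)).exists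
  have hz1 : z ≠ 0 := by
    rintro rfl
    have := hzd.trans_le (min_le_right _ _)
    simp at this
  obtain ⟨k, rfl⟩ := Nat.exists_eq_add_of_le hm
  exact (pottsZ_diamondGraph_ne_zero_iff hz1).2
    (hn z (hzd.trans_le (min_le_left _ _)) k).1 hz0

open Metric in
theorem isPreconnected_ball_diff_singleton (c : ℂ) {ε : ℝ} (hε : 0 < ε) :
    IsPreconnected (ball c ε \ {c}) := by
  have h : ball c ε \ {c} = (fun w => c + Complex.exp w) '' {w : ℂ | w.re < Real.log ε} := by
    ext z
    simp only [Set.mem_sdiff, mem_ball, dist_eq_norm, Set.mem_singleton_iff, Set.mem_image,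
      Set.mem_ofPred_eq]
    constructor
    · rintro ⟨h1, h2⟩
      have h3 : z - c ≠ 0 := sub_ne_zero.2 h2
      exact ⟨Complex.log (z - c), by
        rw [Complex.log_re]; exact Real.log_lt_log (norm_pos_iff.2 h3) h1, by
        rw [Complex.exp_log h3]; ring⟩
    · rintro ⟨w, hw, rfl⟩
      refine ⟨?_, by simp⟩
      rw [add_sub_cancel_left, Complex.norm_exp]
      exact (Real.lt_log_iff_exp_lt hε).1 hw
  rw [h]
  exact (convex_halfSpace_re_lt _).isPreconnected.image _ (by fun_prop)

open Metric in
/-- Where the partition functions do not vanish, the basin of `0` spreads from the centre of a disc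
to the disc of half the radius: the functions `(1 - q) ^ (1 / 4) * transmissivity v q m` omit `1`
and `-1`, so that they are bounded there by Schottky's theorem, and they converge to `0` because
they do so on a small disc. -/
theorem tendsto_transmissivity_of_ball {v a : ℂ} {R : ℝ} {M : ℕ} (hR : 0 < R)
    (h0 : ∀ z ∈ ball a R, z ≠ 0) (h1 : ∀ z ∈ ball a R, z ≠ 1)
    (hP : ∀ m ≥ M, ∀ z ∈ ball a R, (weight v z m).1 + z * (weight v z m).2 ≠ 0)
    (ha : Tendsto (transmissivity v a) atTop (𝓝 0)) {z : ℂ} (hz : z ∈ ball a (R / 2)) :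
    Tendsto (transmissivity v z) atTop (𝓝 0) := by
  have haR : a ∈ ball a R := mem_ball_self hR
  have hzR : z ∈ ball a R := ball_subset_ball (by linarith) hz
  obtain ⟨l, hl, hle⟩ := exists_differentiableOn_exp_eq (g := fun z => 1 - z) (c := a) (r := R)
    (by fun_prop) (fun z hz h => h1 z hz (by linear_combination -h))
  -- a branch of `(1 - z) ^ (1 / 4)`
  set c : ℂ → ℂ := fun z => Complex.exp (l z / 4) with hc
  have hcd : DifferentiableOn ℂ c (ball a R) := (hl.div_const 4).cexp
  have hc4 : ∀ z ∈ ball a R, c z ^ 4 = 1 - z := by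
    intro z hz
    rw [← hle z hz, hc, ← Complex.exp_nat_mul]
    congr 1
    push_cast
    ring
  have hcC : ∀ z ∈ ball a R, ‖c z‖ ≤ 1 + (1 + (‖a‖ + R)) := by
    intro z hz
    have h2 : ‖c z‖ ^ 4 ≤ 1 + (‖a‖ + R) := by
      rw [← norm_pow, hc4 z hz]
      refine (norm_sub_le _ _).trans ?_
      rw [mem_ball, dist_eq_norm] at hz
      have := norm_add_le a (z - a)
      rw [add_sub_cancel] at this
      rw [norm_one]
      linarith
    by_contra! h3
    have h4 : 1 ≤ ‖c z‖ := by nlinarith [norm_nonneg a]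
    have := le_self_pow₀ h4 (by norm_num : 4 ≠ 0)
    linarith
  obtain ⟨δ, hδ, η, n, hn, hδn⟩ := exists_ball_transmissivity_le (m := M) (h0 a haR)
    ((eventually_ge_atTop M).mono fun m hm => hP m hm a haR).frequently ha
  obtain ⟨C, hC⟩ := schottky ((1 + (1 + (‖a‖ + R))) * η)
  set f : ℕ → ℂ → ℂ := fun k z => c z * transmissivity v z (n + k) with hf
  have hη : 0 ≤ η := by
    simpa using (norm_nonneg _).trans (hδn a (mem_ball_self hδ) 0).2
  have hfd : ∀ k, DifferentiableOn ℂ (f k) (ball a R) := fun k =>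
    hcd.mul ((differentiable_weight v _).1.differentiableOn.div
      ((differentiable_weight v _).1.add
        (differentiable_id.mul (differentiable_weight v _).2)).differentiableOn
      fun z hz => hP _ (by omega) z hz)
  -- `f k z ^ 4 = 1` would produce a zero of the next partition function
  have hf4 : ∀ k, ∀ z ∈ ball a R, f k z ^ 4 ≠ 1 := by
    intro k z hz h
    have h2 := hP (n + k) (by omega) z hz
    have h3 := mul_denom_diamondStep h2
    rw [← weight_succ] at h3
    refine mul_ne_zero (h0 z hz) (hP (n + k + 1) (by omega) z hz) (h3.trans ?_)
    rw [hf, mul_pow, hc4 z hz] at h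
    rw [← transmissivity]
    linear_combination (-((weight v z (n + k)).1 + z * (weight v z (n + k)).2) ^ 4) * h
  have hfC : ∀ k, ∀ z ∈ ball a (R / 2), ‖f k z‖ ≤ C := by
    intro k
    refine hC (f k) a R hR (hfd k) (fun z hz h => hf4 k z hz (by rw [h]; norm_num))
      (fun z hz h => hf4 k z hz (by rw [h]; norm_num)) ?_
    rw [hf, norm_mul]
    gcongr
    · exact hcC a haR
    · exact (hδn a (mem_ball_self hδ) k).2.trans
        (mul_le_of_le_one_right hη (pow_le_one₀ (by norm_num) (by norm_num)))
  have hlim := tendsto_zero_of_tendsto_zero_near (f := f) (δ := min (δ / 2) (R / 4))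
    (e := fun k => (1 + (1 + (‖a‖ + R))) * (η * (1 / 2) ^ k))
    (fun k => (hfd k).mono (ball_subset_ball (by linarith))) hfC
    (lt_min (by linarith) (by linarith)) ((min_le_right _ _).trans_lt (by linarith))
    (by simpa using ((tendsto_pow_atTop_nhds_zero_of_lt_one (r := (1 / 2 : ℝ)) (by norm_num)
        (by norm_num)).const_mul η).const_mul (1 + (1 + (‖a‖ + R))))
    (fun k w hw => by
      have hw1 : w ∈ ball a δ := closedBall_subset_ball
        ((min_le_left _ _).trans_lt (by linarith)) hw
      have hw2 : w ∈ ball a R := closedBall_subset_ball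
        ((min_le_right _ _).trans_lt (by linarith)) hw
      rw [hf, norm_mul]
      gcongr
      · exact hcC w hw2
      · exact (hδn w hw1 k).2) hz
  have h5 : Tendsto (fun k => transmissivity v z (k + n)) atTop (𝓝 0) := by
    have := hlim.const_mul (c z)⁻¹
    rw [mul_zero] at this
    refine this.congr fun k => ?_
    rw [hf, add_comm k n]
    exact inv_mul_cancel_left₀ (Complex.exp_ne_zero _) _
  exact (tendsto_add_atTop_iff_nat n).1 h5

open Metric in
/-- The transition criterion: a point every punctured neighbourhood of which meets both the basin
of `0` and its complement lies in the accumulation locus of the zeros. -/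
theorem mem_zeroLocus_of_frequently {v q₀ : ℂ}
    (h1 : ∃ᶠ q in 𝓝[≠] q₀, Tendsto (transmissivity v q) atTop (𝓝 0))
    (h2 : ∃ᶠ q in 𝓝[≠] q₀, ¬ Tendsto (transmissivity v q) atTop (𝓝 0)) :
    q₀ ∈ zeroLocus v := by
  by_contra hmem
  simp only [zeroLocus, Set.mem_ofPred_eq, not_forall, not_frequently] at hmem
  obtain ⟨ε₀, hε₀, hev⟩ := hmem
  obtain ⟨M, hM⟩ := eventually_atTop.1 hev
  have hfin : ∀ᶠ z in 𝓝[≠] q₀, z ≠ 0 ∧ z ≠ 1 := by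
    have hne : ∀ x : ℂ, ∀ᶠ z in 𝓝[≠] q₀, z ≠ x := by
      intro x
      rcases eq_or_ne q₀ x with rfl | h
      · exact eventually_mem_nhdsWithin
      · exact (eventually_ne_nhds h).filter_mono nhdsWithin_le_nhds
    exact (hne 0).and (hne 1)
  rw [eventually_nhdsWithin_iff] at hfin
  obtain ⟨ε₁, hε₁, h01⟩ := Metric.eventually_nhds_iff_ball.1 hfin
  set ε := min ε₀ ε₁
  have hε : 0 < ε := lt_min hε₀ hε₁
  set U := ball q₀ ε \ {q₀} with hU
  have hUo : IsOpen U := isOpen_ball.sdiff isClosed_singleton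
  have hU0 : ∀ z ∈ U, z ≠ 0 := fun z hz =>
    (h01 z (ball_subset_ball (min_le_right _ _) hz.1) hz.2).1
  have hU1 : ∀ z ∈ U, z ≠ 1 := fun z hz =>
    (h01 z (ball_subset_ball (min_le_right _ _) hz.1) hz.2).2
  have hUP : ∀ m ≥ M, ∀ z ∈ U, (weight v z m).1 + z * (weight v z m).2 ≠ 0 := by
    intro m hm z hz
    rw [← pottsZ_diamondGraph_ne_zero_iff (hU0 z hz)]
    intro h
    exact hM m hm ⟨z, hz.2, lt_of_lt_of_le hz.1 (min_le_left _ _), h⟩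
  have hnear : U ∈ 𝓝[≠] q₀ :=
    sdiff_mem_nhdsWithin_compl (ball_mem_nhds q₀ hε) {q₀}
  set N := {q ∈ U | Tendsto (transmissivity v q) atTop (𝓝 0)} with hN
  have hclosed : ∀ z ∈ closure N ∩ U, ∃ ρ > 0, ball z ρ ⊆ N := by
    rintro z ⟨hz, hzU⟩
    obtain ⟨ρ, hρ, hρU⟩ := Metric.isOpen_iff.1 hUo z hzU
    obtain ⟨a, ha, haz⟩ := Metric.mem_closure_iff.1 hz (ρ / 8) (by linarith)
    have hsub : ball a (ρ / 2) ⊆ U := (ball_subset_ball' (by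
      rw [dist_comm]; linarith)).trans hρU
    refine ⟨ρ / 8, by linarith, fun w hw => ?_⟩
    have hwa : w ∈ ball a (ρ / 2 / 2) := by
      have := dist_triangle w z a
      rw [mem_ball] at hw ⊢
      linarith
    exact ⟨hsub (ball_subset_ball (by linarith) hwa),
      tendsto_transmissivity_of_ball (by linarith) (fun x hx => hU0 x (hsub hx))
      (fun x hx => hU1 x (hsub hx)) (fun m hm x hx => hUP m hm x (hsub hx)) ha.2 hwa⟩
  have hNo : IsOpen N := Metric.isOpen_iff.2 fun z hz =>
    hclosed z ⟨subset_closure hz, hz.1⟩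
  obtain ⟨a, haN, haU⟩ := (h1.and_eventually hnear).exists
  obtain ⟨b, hbN, hbU⟩ := (h2.and_eventually hnear).exists
  refine hbN ((isPreconnected_ball_diff_singleton q₀ hε).subset_of_closure_inter_subset hNo
    ⟨a, haU, haU, haN⟩ (fun z hz => ?_) hbU).2
  obtain ⟨ρ, hρ, hρN⟩ := hclosed z hz
  exact hρN (mem_ball_self hρ)

/-! ### Real dynamics -/

theorem weight_ofReal (v q : ℝ) (m : ℕ) :
    weight (v : ℂ) (q : ℂ) m = (((weight v q m).1 : ℂ), ((weight v q m).2 : ℂ)) := by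
  induction m with
  | zero => simp [weight]
  | succ m ih => simp [weight_succ, ih, diamondStep]

theorem transmissivity_ofReal (v q : ℝ) (m : ℕ) :
    transmissivity (v : ℂ) (q : ℂ) m = (transmissivity v q m : ℝ) := by
  simp [transmissivity, weight_ofReal]

theorem tendsto_transmissivity_ofReal {v q : ℝ} :
    Tendsto (transmissivity (v : ℂ) (q : ℂ)) atTop (𝓝 0) ↔
      Tendsto (transmissivity v q) atTop (𝓝 0) := by
  rw [tendsto_zero_iff_norm_tendsto_zero,
    tendsto_zero_iff_norm_tendsto_zero (f := transmissivity v q)]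
  exact tendsto_congr fun m => by rw [transmissivity_ofReal, Complex.norm_real]

theorem mem_zeroLocus_ofReal {v x : ℝ}
    (h1 : ∃ᶠ q : ℝ in 𝓝[≠] x, Tendsto (transmissivity v q) atTop (𝓝 0))
    (h2 : ∃ᶠ q : ℝ in 𝓝[≠] x, ¬ Tendsto (transmissivity v q) atTop (𝓝 0)) :
    (x : ℂ) ∈ zeroLocus (v : ℂ) := by
  have ht : Tendsto (fun y : ℝ => (y : ℂ)) (𝓝[≠] x) (𝓝[≠] (x : ℂ)) :=
    tendsto_nhdsWithin_of_tendsto_nhds_of_eventually_within _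
      (Complex.continuous_ofReal.continuousAt.tendsto.mono_left nhdsWithin_le_nhds)
      (eventually_mem_nhdsWithin.mono fun y hy => by simpa using hy)
  exact mem_zeroLocus_of_frequently
    (ht.frequently (h1.mono fun q hq => tendsto_transmissivity_ofReal.2 hq))
    (ht.frequently (h2.mono fun q hq => fun h => hq (tendsto_transmissivity_ofReal.1 h)))

/-- The renormalized weight of the edges of `D_m` is nonzero (possibly infinite), and `X` is the
quotient of `q` by it. The transmissivity is then `1 / (1 + X)`. -/
def HasCoord (v q : ℝ) (m : ℕ) (X : ℝ) : Prop :=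
  (weight v q m).1 ≠ 0 ∧ q * (weight v q m).2 = X * (weight v q m).1

theorem hasCoord_zero {v : ℝ} (hv : v ≠ 0) (q : ℝ) : HasCoord v q 0 (q / v) := by
  refine ⟨by simpa [weight] using hv, ?_⟩
  simp [weight]
  field_simp

theorem HasCoord.mul_weight_succ {v q X : ℝ} {m : ℕ} (h : HasCoord v q m X) :
    q * (weight v q (m + 1)).1 = (weight v q m).1 ^ 4 * (2 * (X * (X + 2)) + q) ∧
      q * (q * (weight v q (m + 1)).2) = (weight v q m).1 ^ 4 * (X * (X + 2)) ^ 2 := by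
  obtain ⟨-, h⟩ := h
  rw [weight_succ]
  simp only [diamondStep]
  generalize (weight v q m).1 = A at *
  generalize (weight v q m).2 = B at *
  constructor
  · linear_combination A ^ 2 * (2 * q * B + 2 * X * A + 4 * A) * h
  · rw [show q * (q * (B * (q * B + 2 * A)) ^ 2) = ((q * B) * (q * B + 2 * A)) ^ 2 by ring, h]
    ring

theorem HasCoord.succ {v q X : ℝ} {m : ℕ} (h : HasCoord v q m X) (hq : q ≠ 0)
    (hd : 2 * (X * (X + 2)) + q ≠ 0) :
    HasCoord v q (m + 1) ((X * (X + 2)) ^ 2 / (2 * (X * (X + 2)) + q)) := by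
  obtain ⟨h1, h2⟩ := h.mul_weight_succ
  refine ⟨fun h0 => ?_, ?_⟩
  · rw [h0, mul_zero] at h1
    exact mul_ne_zero (pow_ne_zero 4 h.1) hd h1.symm
  · apply mul_left_cancel₀ hq
    rw [h2, mul_left_comm, h1, mul_left_comm, div_mul_cancel₀ _ hd]

theorem HasCoord.denom_eq {v q X : ℝ} {m : ℕ} (h : HasCoord v q m X) :
    (weight v q m).1 + q * (weight v q m).2 = (weight v q m).1 * (1 + X) := by
  rw [h.2]
  ring

theorem HasCoord.transmissivity_eq {v q X : ℝ} {m : ℕ} (h : HasCoord v q m X) :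
    transmissivity v q m = 1 / (1 + X) := by
  rw [transmissivity, h.denom_eq, div_mul_eq_div_div, div_self h.1]

theorem not_tendsto_transmissivity {v q c : ℝ} {m : ℕ} (hc : 0 < c)
    (h : ∀ k, ∃ X, HasCoord v q (m + k) X ∧ c ≤ 1 / (1 + X)) :
    ¬ Tendsto (transmissivity v q) atTop (𝓝 0) := by
  intro ht
  obtain ⟨n, hn, hn'⟩ :=
    ((ht.eventually_lt_const hc).and (eventually_ge_atTop m)).exists
  obtain ⟨k, rfl⟩ := Nat.exists_eq_add_of_le hn'
  obtain ⟨X, hX, hXc⟩ := h k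
  rw [hX.transmissivity_eq] at hn
  linarith

/-- Below the positive root `s` of `s ^ 2 * (s + 2) = q`, the repelling fixed point that separates
the ferromagnetic from the paramagnetic phase, the coordinate stays bounded. -/
theorem not_tendsto_of_hasCoord_le {v q s X : ℝ} {m : ℕ} (hq : 0 < q) (hs : s ^ 2 * (s + 2) ≤ q)
    (h : HasCoord v q m X) (hX0 : 0 ≤ X) (hXs : X ≤ s) :
    ¬ Tendsto (transmissivity v q) atTop (𝓝 0) := by
  have hs0 : 0 ≤ s := hX0.trans hXs
  have key : ∀ k, ∃ X, HasCoord v q (m + k) X ∧ 0 ≤ X ∧ X ≤ s := by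
    intro k
    induction k with
    | zero => exact ⟨X, h, hX0, hXs⟩
    | succ k ih =>
      obtain ⟨X, h, hX0, hXs⟩ := ih
      have hS0 : 0 ≤ X * (X + 2) := by positivity
      have hSs : X * (X + 2) ≤ s * (s + 2) := by gcongr
      have hd : 0 < 2 * (X * (X + 2)) + q := by positivity
      refine ⟨_, h.succ hq.ne' hd.ne', by positivity, ?_⟩
      rw [div_le_iff₀ hd]
      generalize X * (X + 2) = S at *
      have h1 : S * s ^ 2 ≤ (s * (s + 2)) * s ^ 2 := by gcongr
      have h2 : S * (S - 2 * s) ≤ S * s ^ 2 := by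
        gcongr; linarith
      nlinarith
  refine not_tendsto_transmissivity (m := m) (c := 1 / (1 + s)) (by positivity) fun k => ?_
  obtain ⟨X, hX, h0, h1⟩ := key k
  exact ⟨X, hX, by gcongr⟩

/-- For small `q > 0` the coordinate converges to a negative fixed point; it suffices that it
remains in an invariant interval. -/
theorem not_tendsto_of_small {v q : ℝ} (hv1 : -1 ≤ v) (hv0 : v < 0) (hq : 0 < q)
    (hqv : q ≤ -v / 2) (hq1 : q ≤ 3 / 8) :
    ¬ Tendsto (transmissivity v q) atTop (𝓝 0) := by
  -- the interval `[q, 1/2]` of values of `Y = -X` is invariant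
  have key : ∀ k, ∃ Y, HasCoord v q k (-Y) ∧ q ≤ Y ∧ Y ≤ 1 / 2 := by
    intro k
    induction k with
    | zero =>
      refine ⟨q / -v, ?_, ?_, ?_⟩
      · convert hasCoord_zero hv0.ne q using 1
        rw [div_neg, neg_neg]
      · rw [le_div_iff₀ (by linarith)]
        nlinarith
      · rw [div_le_iff₀ (by linarith)]
        linarith
    | succ k ih =>
      obtain ⟨Y, hY, hY0, hY1⟩ := ih
      have e : -Y * (-Y + 2) = -(Y * (2 - Y)) := by ring
      have hS0 : q ≤ Y * (2 - Y) := by nlinarith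
      have hS1 : Y * (2 - Y) ≤ 3 / 4 := by nlinarith
      have h2 := hY.succ hq.ne'
      rw [e] at h2
      generalize Y * (2 - Y) = S at *
      have hd : 0 < 2 * S - q := by linarith
      refine ⟨S ^ 2 / (2 * S - q), ?_, ?_, ?_⟩
      · convert h2 (by linarith) using 1
        rw [neg_sq, ← div_neg]
        congr 1
        ring
      · rw [le_div_iff₀ hd]
        nlinarith [sq_nonneg (S - q)]
      · rw [div_le_iff₀ hd]
        nlinarith [mul_nonneg (sub_nonneg.2 hS0) (sub_nonneg.2 hS1)]
  refine not_tendsto_transmissivity (m := 0) (c := 1) one_pos fun k => ?_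
  obtain ⟨Y, hY, h0, h1⟩ := key k
  refine ⟨-Y, by simpa using hY, ?_⟩
  rw [le_div_iff₀ (by linarith)]
  linarith

/-- Beyond the largest fixed point the coordinate increases to infinity. -/
theorem tendsto_of_hasCoord {v q X₀ : ℝ} {m : ℕ} (hq : q ≠ 0) (h : HasCoord v q m X₀)
    (h0 : 0 < X₀) (hfix : q < X₀ ^ 2 * (X₀ + 2)) (hd : 0 < 2 * (X₀ * (X₀ + 2)) + q) :
    Tendsto (transmissivity v q) atTop (𝓝 0) ∧
      ∃ᶠ m in atTop, (weight v q m).1 + q * (weight v q m).2 ≠ 0 := by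
  set g : ℝ → ℝ := fun X => (X * (X + 2)) ^ 2 / (2 * (X * (X + 2)) + q) with hg
  have hd' : ∀ X, X₀ ≤ X → 0 < 2 * (X * (X + 2)) + q := by
    intro X hX
    have h2 : 0 < X := h0.trans_le hX
    have : X₀ * (X₀ + 2) ≤ X * (X + 2) := by gcongr
    linarith
  have hfix' : ∀ X, X₀ ≤ X → q < X ^ 2 * (X + 2) := by
    intro X hX
    have : X₀ ^ 2 * (X₀ + 2) ≤ X ^ 2 * (X + 2) := by gcongr
    linarith
  have hinc : ∀ X, X₀ ≤ X → X ≤ g X := by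
    intro X hX
    rw [hg, le_div_iff₀ (hd' X hX)]
    have h1 := hfix' X hX
    have h2 : 0 < X := h0.trans_le hX
    nlinarith
  set x : ℕ → ℝ := fun k => g^[k] X₀ with hx
  have hxs : ∀ k, x (k + 1) = g (x k) := fun k => Function.iterate_succ_apply' g k X₀
  have hx0 : ∀ k, X₀ ≤ x k := by
    intro k
    induction k with
    | zero => exact le_rfl
    | succ k ih => exact ih.trans (by rw [hxs]; exact hinc _ ih)
  have hmono : Monotone x := monotone_nat_of_le_succ fun k => by rw [hxs]; exact hinc _ (hx0 k)
  have hcoord : ∀ k, HasCoord v q (m + k) (x k) := by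
    intro k
    induction k with
    | zero => exact h
    | succ k ih =>
      rw [hxs]
      exact ih.succ hq (hd' _ (hx0 k)).ne'
  have hlim : Tendsto x atTop atTop := by
    rcases tendsto_atTop_of_monotone hmono with h | ⟨L, hL⟩
    · exact h
    · exfalso
      have hL0 : X₀ ≤ L := ge_of_tendsto' hL hx0
      have hgc : Tendsto (fun k => g (x k)) atTop (𝓝 (g L)) := by
        refine Tendsto.div ?_ ?_ (hd' L hL0).ne'
        · exact (hL.mul (hL.add_const 2)).pow 2
        · exact ((hL.mul (hL.add_const 2)).const_mul 2).add_const q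
      have hfp : g L = L := tendsto_nhds_unique hgc (by
        simp_rw [← hxs]
        exact (tendsto_add_atTop_iff_nat 1).2 hL)
      rw [hg, div_eq_iff (hd' L hL0).ne'] at hfp
      have h1 := hfix' L hL0
      have h2 : 0 < L := h0.trans_le hL0
      nlinarith
  refine ⟨?_, ?_⟩
  · rw [← tendsto_add_atTop_iff_nat m]
    have : ∀ k, transmissivity v q (k + m) = (1 + x k)⁻¹ := fun k => by
      rw [add_comm, (hcoord k).transmissivity_eq, one_div]
    simp_rw [this]
    exact (tendsto_atTop_add_const_left _ 1 hlim).inv_tendsto_atTop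
  · refine Eventually.frequently ((eventually_ge_atTop m).mono fun n hn => ?_)
    obtain ⟨k, rfl⟩ := Nat.exists_eq_add_of_le hn
    rw [(hcoord k).denom_eq]
    exact mul_ne_zero (hcoord k).1 (by linarith [hx0 k])

theorem tendsto_of_weight_eq_zero {v q : ℝ} {j : ℕ} (h : (weight v q j).1 = 0) :
    Tendsto (transmissivity v q) atTop (𝓝 0) := by
  have : ∀ k, (weight v q (j + k)).1 = 0 := by
    intro k
    induction k with
    | zero => exact h
    | succ k ih => rw [← add_assoc, weight_succ, diamondStep, ih]; simp
  refine tendsto_const_nhds.congr' ((eventually_ge_atTop j).mono fun n hn => ?_)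
  obtain ⟨k, rfl⟩ := Nat.exists_eq_add_of_le hn
  simp [transmissivity, this]

/-- The homogeneous coordinates of the renormalized weight do not degenerate for `q ≠ 0`. -/
theorem weight_ne_zero {K : Type*} [Field K] {v q : K} (hq : q ≠ 0) (m : ℕ) :
    (weight v q m).1 ≠ 0 ∨ (weight v q m).2 ≠ 0 := by
  induction m with
  | zero => simp [weight]
  | succ m ih =>
    by_contra! h
    rw [weight_succ] at h
    simp only [diamondStep] at h
    generalize (weight v q m).1 = A at *
    generalize (weight v q m).2 = B at *
    obtain ⟨h1, h2⟩ := h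
    have h4 : A = 0 := by
      rcases mul_eq_zero.1 (pow_eq_zero_iff (by norm_num) |>.1 h2) with h3 | h3
      · rw [h3] at h1
        exact pow_eq_zero_iff (n := 4) (by norm_num) |>.1 (by linear_combination h1)
      · exact pow_eq_zero_iff (n := 4) (by norm_num) |>.1
          (by linear_combination h1 - 2 * A ^ 2 * B * h3)
    subst h4
    simp [hq] at h2 ih
    exact ih h2

/-- Two consecutive partition functions have no common zero `q ≠ 0`, except possibly `q = 1`, where
`v = -1` is an exceptional fixed point of the renormalization. -/
theorem frequently_denom_ne_zero {K : Type*} [Field K] {v q : K} (hq : q ≠ 0) (hq1 : q ≠ 1) :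
    ∃ᶠ m in atTop, (weight v q m).1 + q * (weight v q m).2 ≠ 0 := by
  rw [frequently_atTop]
  intro a
  by_contra! h
  have h1 := h a le_rfl
  have h2 := h (a + 1) (by omega)
  rw [weight_succ] at h2
  simp only [diamondStep] at h2
  have hnz := weight_ne_zero (v := v) hq a
  generalize (weight v q a).1 = A at *
  generalize (weight v q a).2 = B at *
  have hA : A = -(q * B) := by linear_combination h1
  subst hA
  have : q ^ 3 * B ^ 4 * (q - 1) = 0 := by linear_combination h2
  have hB : B = 0 := by
    simpa [hq, sub_ne_zero.2 hq1] using this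
  simp [hB] at hnz

/-- The real points of the basin of `0` form an open set, away from `q = 0` and `q = 1`. -/
theorem eventually_tendsto_transmissivity {v q : ℝ} (hq : q ≠ 0) (hq1 : q ≠ 1)
    (h : Tendsto (transmissivity v q) atTop (𝓝 0)) :
    ∀ᶠ x in 𝓝 q, Tendsto (transmissivity v x) atTop (𝓝 0) := by
  obtain ⟨δ, hδ, η, n, -, hn⟩ := exists_ball_transmissivity_le (v := v) (q := q) (m := 0)
    (by exact_mod_cast hq)
    (frequently_denom_ne_zero (by exact_mod_cast hq) (by exact_mod_cast hq1))
    (tendsto_transmissivity_ofReal.2 h)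
  filter_upwards [Metric.ball_mem_nhds q hδ] with x hx
  rw [← tendsto_transmissivity_ofReal, ← tendsto_add_atTop_iff_nat n]
  refine squeeze_zero_norm (a := fun k => η * (1 / 2) ^ k) (fun k => by
    rw [add_comm]
    exact (hn x (by simpa [← Complex.ofReal_sub, Complex.dist_eq, Real.dist_eq] using hx) k).2) ?_
  simpa using (tendsto_pow_atTop_nhds_zero_of_lt_one (r := (1 / 2 : ℝ)) (by norm_num)
    (by norm_num)).const_mul η

/-- If the basin of `0` contains `a` but no point near `b < a`, then between the two there is a
boundary point of the basin, and it belongs to the accumulation locus. -/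
theorem exists_mem_zeroLocus_between {v a b : ℝ} (hb : 0 < b) (hba : b < a)
    (h1 : ∀ x ∈ Set.Icc b a, x ≠ 1)
    (ha : Tendsto (transmissivity v a) atTop (𝓝 0))
    (hbn : ∀ᶠ x in 𝓝 b, ¬ Tendsto (transmissivity v x) atTop (𝓝 0)) :
    ∃ x, b < x ∧ x ≤ a ∧ (x : ℂ) ∈ zeroLocus (v : ℂ) := by
  set T := {y ∈ Set.Icc b a | Tendsto (transmissivity v y) atTop (𝓝 0)} with hT
  have haT : a ∈ T := ⟨⟨hba.le, le_rfl⟩, ha⟩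
  have hbdd : BddBelow T := ⟨b, fun y hy => hy.1.1⟩
  -- the boundary point is the infimum of the basin in the interval
  set x := sInf T with hx
  have hxa : x ≤ a := csInf_le hbdd haT
  obtain ⟨c, hbc, hc⟩ : ∃ c > b, ∀ y ∈ Set.Ico b c,
      ¬ Tendsto (transmissivity v y) atTop (𝓝 0) := by
    obtain ⟨l, u, ⟨hl, hu⟩, h⟩ := mem_nhds_iff_exists_Ioo_subset.1 hbn
    exact ⟨u, hu, fun y hy => h ⟨hl.trans_le hy.1, hy.2⟩⟩
  have hbx : b < x := hbc.trans_le (le_csInf ⟨a, haT⟩ fun y hy => by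
    by_contra! h
    exact hc y ⟨hy.1.1, h⟩ hy.2)
  have hleft : ∀ y ∈ Set.Ioo b x, ¬ Tendsto (transmissivity v y) atTop (𝓝 0) :=
    fun y hy h => (csInf_le hbdd ⟨⟨hy.1.le, hy.2.le.trans hxa⟩, h⟩).not_gt hy.2
  have hlt : ∀ᶠ y in 𝓝[<] x, ¬ Tendsto (transmissivity v y) atTop (𝓝 0) := by
    filter_upwards [Ioo_mem_nhdsLT hbx] with y hy using hleft y hy
  have hxT : ¬ Tendsto (transmissivity v x) atTop (𝓝 0) := by
    intro h
    have h2 := (eventually_tendsto_transmissivity (hb.trans hbx).ne' (h1 x ⟨hbx.le, hxa⟩)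
      h).filter_mono (nhdsWithin_le_nhds (s := Set.Iio x))
    obtain ⟨y, hy1, hy2⟩ := (h2.and hlt).exists
    exact hy2 hy1
  refine ⟨x, hbx, hxa, mem_zeroLocus_ofReal ?_ ?_⟩
  · rw [Metric.nhdsWithin_basis_ball.frequently_iff]
    intro ε hε
    obtain ⟨y, hy, hyx⟩ := exists_lt_of_csInf_lt ⟨a, haT⟩ (show sInf T < x + ε by linarith)
    have hxy : x ≤ y := csInf_le hbdd hy
    refine ⟨y, ⟨?_, fun h => hxT (h ▸ hy.2)⟩, hy.2⟩
    rw [Metric.mem_ball, Real.dist_eq, abs_of_nonneg (by linarith)]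
    linarith
  · exact hlt.frequently.filter_mono (nhdsWithin_mono _ fun y hy => ne_of_lt hy)

/-! ### The points `0`, `q_c` and `q_∞` -/

/-- The negative `-X` of the coordinate of the renormalized weight, as long as the latter is
finite, that is, as long as `2 * (ξ * (2 - ξ)) ≠ q`. -/
noncomputable def xi (v q : ℝ) : ℕ → ℝ
  | 0 => -(q / v)
  | n + 1 => (xi v q n * (2 - xi v q n)) ^ 2 / (2 * (xi v q n * (2 - xi v q n)) - q)

theorem hasCoord_xi {v q : ℝ} (hv : v ≠ 0) (hq : q ≠ 0) {j : ℕ}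
    (hd : ∀ i < j, 2 * (xi v q i * (2 - xi v q i)) - q ≠ 0) : HasCoord v q j (-xi v q j) := by
  induction j with
  | zero => simpa [xi] using hasCoord_zero hv q
  | succ j ih =>
    have h := hd j j.lt_succ_self
    have e : 2 * (-xi v q j * (-xi v q j + 2)) + q = -(2 * (xi v q j * (2 - xi v q j)) - q) := by
      ring
    have h2 := (ih fun i hi => hd i (hi.trans j.lt_succ_self)).succ hq (by
      rw [e]; exact neg_ne_zero.2 h)
    have e' : (-xi v q j * (-xi v q j + 2)) ^ 2 = (xi v q j * (2 - xi v q j)) ^ 2 := by ring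
    rw [e, e', div_neg] at h2
    exact h2

/-- Without fixed points ahead, the orbit of `ξ` leaves the region where the map increases. -/
theorem exists_xi_escape {v q : ℝ} (hq : 0 < q) (h0 : 0 < -(q / v))
    (hesc : ∀ y, -(q / v) ≤ y → y ^ 2 * (2 - y) < q) :
    ∃ j, 2 * (xi v q j * (2 - xi v q j)) - q ≤ 0 := by
  by_contra! hd
  have hx0 : ∀ n, -(q / v) ≤ xi v q n ∧ xi v q n ≤ xi v q (n + 1) := by
    have step : ∀ n, -(q / v) ≤ xi v q n → xi v q n ≤ xi v q (n + 1) := by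
      intro n hn
      rw [xi, le_div_iff₀ (hd n)]
      have h1 := hesc _ hn
      have h2 : 0 < xi v q n := h0.trans_le hn
      nlinarith
    intro n
    induction n with
    | zero => exact ⟨le_rfl, step 0 le_rfl⟩
    | succ n ih => exact ⟨ih.1.trans ih.2, step _ (ih.1.trans ih.2)⟩
  have hmono : Monotone (xi v q) := monotone_nat_of_le_succ fun n => (hx0 n).2
  have hbdd : ∀ n, xi v q n ≤ 2 := by
    intro n
    have h1 := hd n
    have h2 : 0 < xi v q n := h0.trans_le (hx0 n).1
    by_contra! h3
    nlinarith
  rcases tendsto_atTop_of_monotone hmono with h | ⟨L, hL⟩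
  · obtain ⟨n, hn⟩ := (h.eventually_gt_atTop 2).exists
    exact (hbdd n).not_gt hn
  · have hL0 : -(q / v) ≤ L := ge_of_tendsto' hL fun n => (hx0 n).1
    have hLS : Tendsto (fun n => xi v q n * (2 - xi v q n)) atTop (𝓝 (L * (2 - L))) :=
      hL.mul (hL.const_sub 2)
    have h1 : Tendsto (fun n => xi v q (n + 1) * (2 * (xi v q n * (2 - xi v q n)) - q)) atTop
        (𝓝 (L * (2 * (L * (2 - L)) - q))) :=
      ((tendsto_add_atTop_iff_nat 1).2 hL).mul ((hLS.const_mul 2).sub_const q)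
    have h2 : L * (2 * (L * (2 - L)) - q) = (L * (2 - L)) ^ 2 := by
      refine tendsto_nhds_unique h1 ((hLS.pow 2).congr fun n => ?_)
      rw [xi, div_mul_cancel₀ _ (hd n).ne']
    have h3 := hesc L hL0
    have h4 : 0 < L := h0.trans_le hL0
    nlinarith

/-- If the orbit of `ξ` stays bounded at `q = qi` but escapes for every `q > qi`, boundary points
of the basin of `0` accumulate at `qi` from above. At the least `a` where the `j`-th point of the
orbit hits the pole, the weight vanishes; by continuity the next point takes the
value `2`, whose image is the superattracting infinite weight, for some `b < a`. -/
theorem exists_mem_zeroLocus_of_escape {v qi q₀ : ℝ} (hv : v < 0) (hqi : 0 < qi) (hq₀ : qi < q₀)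
    (hone : ∀ x ∈ Set.Ioc qi q₀, x ≠ 1)
    (hinf : ∀ n, 0 < 2 * (xi v qi n * (2 - xi v qi n)) - qi ∧ xi v qi n < 2)
    (hesc : ∀ q, qi < q → ∀ y, -(q / v) ≤ y → y ^ 2 * (2 - y) < q) :
    ∃ q, qi < q ∧ q ≤ q₀ ∧ (q : ℂ) ∈ zeroLocus (v : ℂ) := by
  classical
  set σ : ℕ → ℝ → ℝ := fun n q => xi v q n * (2 - xi v q n) with hσ
  set d : ℕ → ℝ → ℝ := fun n q => 2 * σ n q - q with hd
  have hxi : ∀ n q, xi v q (n + 1) = σ n q ^ 2 / d n q := fun n q => rfl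
  have hesc' : ∃ j, ∃ q ∈ Set.Icc qi q₀, d j q ≤ 0 := by
    have h0 : 0 < -(q₀ / v) := by
      rw [← div_neg]
      exact div_pos (hqi.trans hq₀) (by linarith)
    obtain ⟨j, hj⟩ := exists_xi_escape (hqi.trans hq₀) h0 (hesc q₀ hq₀)
    exact ⟨j, q₀, ⟨hq₀.le, le_rfl⟩, hj⟩
  -- with `j` minimal, the orbit up to `ξ_j` depends continuously on `q` on the whole interval
  set j := Nat.find hesc' with hj
  have hdi : ∀ i < j, ∀ q ∈ Set.Icc qi q₀, 0 < d i q := by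
    intro i hi q hq
    have := Nat.find_min hesc' hi
    push Not at this
    exact this q hq
  have hcont : ∀ i ≤ j, ContinuousOn (fun q => xi v q i) (Set.Icc qi q₀) := by
    intro i
    induction i with
    | zero =>
      intro _
      simp only [xi]
      fun_prop
    | succ i ih =>
      intro hi
      have hc := ih (by omega)
      simp only [xi]
      refine ContinuousOn.div (by fun_prop) (by fun_prop) fun q hq => ?_
      exact (hdi i (by omega) q hq).ne'
  have hcj := hcont j le_rfl
  have hσc : ContinuousOn (σ j) (Set.Icc qi q₀) := by simp only [hσ]; fun_prop
  have hdc : ContinuousOn (d j) (Set.Icc qi q₀) := by simp only [hd]; fun_prop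
  -- the first zero `a` of `d j`
  obtain ⟨a, ⟨haI, had⟩, hamin⟩ : ∃ a, IsLeast {q ∈ Set.Icc qi q₀ | d j q = 0} a := by
    refine IsCompact.exists_isLeast ?_ ?_
    · exact isCompact_Icc.of_isClosed_subset
        (hdc.preimage_isClosed_of_isClosed isClosed_Icc isClosed_singleton) fun q hq => hq.1
    · obtain ⟨q, hq, hqd⟩ := Nat.find_spec hesc'
      obtain ⟨x, hx, hxd⟩ := intermediate_value_Icc' hq.1
        (hdc.mono (Set.Icc_subset_Icc_right hq.2)) ⟨hqd, (hinf j).1.le⟩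
      exact ⟨x, ⟨hx.1, hx.2.trans hq.2⟩, hxd⟩
  have hdpos : ∀ q, qi ≤ q → q < a → 0 < d j q := by
    intro q hq hqa
    by_contra! h
    obtain ⟨x, hx, hxd⟩ := intermediate_value_Icc' hq
      (hdc.mono (Set.Icc_subset_Icc_right (hqa.le.trans haI.2))) ⟨h, (hinf j).1.le⟩
    exact (hamin ⟨⟨hx.1, hx.2.trans (hqa.le.trans haI.2)⟩, hxd⟩).not_gt (hx.2.trans_lt hqa)
  have hqia : qi < a := by
    refine lt_of_le_of_ne haI.1 fun h => ?_
    rw [← h] at had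
    exact (hinf j).1.ne' had
  have hcoord : ∀ q ∈ Set.Icc qi q₀, HasCoord v q j (-xi v q j) := fun q hq =>
    hasCoord_xi hv.ne (hqi.trans_le hq.1).ne' fun i hi => (hdi i hi q hq).ne'
  have haN : Tendsto (transmissivity v a) atTop (𝓝 0) := by
    refine tendsto_of_weight_eq_zero (j := j + 1) ?_
    have h1 := (hcoord a haI).mul_weight_succ.1
    have h2 : 2 * (-xi v a j * (-xi v a j + 2)) + a = 0 := by
      have : 2 * (xi v a j * (2 - xi v a j)) - a = 0 := had
      linear_combination -this
    rw [h2, mul_zero] at h1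
    exact (mul_eq_zero.1 h1).resolve_left (hqi.trans hqia).ne'
  -- `σ ^ 2 = 2 * d` says that `ξ_{j+1} = 2`; in this form the pole at `a` is harmless
  obtain ⟨b, hb, hbφ⟩ : ∃ b ∈ Set.Ioo qi a, σ j b ^ 2 - 2 * d j b = 0 := by
    have hc : ContinuousOn (fun q => σ j q ^ 2 - 2 * d j q) (Set.Icc qi a) :=
      ((hσc.pow 2).sub (hdc.const_mul 2)).mono (Set.Icc_subset_Icc_right haI.2)
    refine intermediate_value_Ioo hqia.le hc ⟨?_, ?_⟩
    · have h1 := (hinf (j + 1)).2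
      rw [hxi, div_lt_iff₀ (hinf j).1] at h1
      exact sub_neg.2 h1
    · have h1 : 2 * σ j a - a = 0 := had
      have h2 : 0 < σ j a := by linarith
      simp only [had]
      nlinarith
  have hdb : 0 < d j b := hdpos b hb.1.le hb.2
  have hxb : xi v b (j + 1) = 2 := by
    rw [hxi, div_eq_iff hdb.ne']
    linear_combination hbφ
  have hIb : Set.Icc qi q₀ ∈ 𝓝 b := Icc_mem_nhds hb.1 (hb.2.trans_le haI.2)
  have hcb : ContinuousAt (fun q => xi v q (j + 1)) b := by
    simp only [hxi]
    exact ((hσc.continuousAt hIb).pow 2).div (hdc.continuousAt hIb) hdb.ne'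
  -- near `b` the coordinate after step `j + 2` is small and nonnegative
  have hbn : ∀ᶠ x in 𝓝 b, ¬ Tendsto (transmissivity v x) atTop (𝓝 0) := by
    set s := min 1 (qi / 3) with hs
    have hs0 : 0 < s := lt_min one_pos (by linarith)
    have hs2 : s ^ 2 * (s + 2) ≤ qi := by
      have h1 : s ≤ 1 := min_le_left _ _
      have h2 : s ≤ qi / 3 := min_le_right _ _
      have h3 : s ^ 2 ≤ s := by nlinarith
      nlinarith
    have hdc2 : ContinuousAt (fun q => q - 2 * (xi v q (j + 1) * (2 - xi v q (j + 1)))) b := by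
      fun_prop
    have hd2 : 0 < b - 2 * (xi v b (j + 1) * (2 - xi v b (j + 1))) := by
      rw [hxb]; linarith [hb.1]
    have e1 : ∀ᶠ q in 𝓝 b, 0 < q - 2 * (xi v q (j + 1) * (2 - xi v q (j + 1))) :=
      hdc2.tendsto.eventually_const_lt hd2
    have e2 : ∀ᶠ q in 𝓝 b, (xi v q (j + 1) * (2 - xi v q (j + 1))) ^ 2 /
        (q - 2 * (xi v q (j + 1) * (2 - xi v q (j + 1)))) < s := by
      refine (ContinuousAt.div (by fun_prop) hdc2 hd2.ne').tendsto.eventually_lt_const ?_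
      simpa [hxb] using hs0
    filter_upwards [e1, e2, Ioo_mem_nhds hb.1 hb.2] with q h1 h2 hq
    have hqI : q ∈ Set.Icc qi q₀ := ⟨hq.1.le, hq.2.le.trans haI.2⟩
    have hq0 : 0 < q := hqi.trans hq.1
    have hc : HasCoord v q (j + 1) (-xi v q (j + 1)) := by
      refine hasCoord_xi hv.ne hq0.ne' fun i hi => ?_
      rcases Nat.lt_succ_iff_lt_or_eq.1 hi with h | rfl
      · exact (hdi i h q hqI).ne'
      · exact (hdpos q hq.1.le hq.2).ne'
    have e : 2 * (-xi v q (j + 1) * (-xi v q (j + 1) + 2)) + q =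
      q - 2 * (xi v q (j + 1) * (2 - xi v q (j + 1))) := by ring
    have e' : (-xi v q (j + 1) * (-xi v q (j + 1) + 2)) ^ 2 =
      (xi v q (j + 1) * (2 - xi v q (j + 1))) ^ 2 := by ring
    have hc2 := hc.succ hq0.ne' (by rw [e]; exact h1.ne')
    rw [e, e'] at hc2
    exact not_tendsto_of_hasCoord_le hq0 (hs2.trans hq.1.le) hc2 (by positivity) h2.le
  obtain ⟨x, hbx, hxa, hx⟩ := exists_mem_zeroLocus_between (hqi.trans hb.1) hb.2
    (fun x hx => hone x ⟨hb.1.trans_le hx.1, hx.2.trans haI.2⟩) haN hbn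
  exact ⟨x, hb.1.trans hbx, hxa.trans haI.2, hx⟩

/-- The first step of the renormalization at `v = -s ^ 2`: two edges in series have the weight
`w = s ^ 4 / (q - 2 * s ^ 2)`, and two of these in parallel have the weight `w * (2 + w)`. -/
theorem hasCoord_one {s q : ℝ} (hs : 0 < s) (hq : 2 * s ^ 2 < q) :
    HasCoord (-s ^ 2) q 1 (q / (s ^ 4 / (q - 2 * s ^ 2) * (2 + s ^ 4 / (q - 2 * s ^ 2)))) := by
  have h1 : 0 < q - 2 * s ^ 2 := by linarith
  have h2 : 0 < 2 * (q - 2 * s ^ 2) + s ^ 4 := by positivity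
  have hA : (weight (-s ^ 2) q 1).1 = s ^ 4 * (2 * (q - 2 * s ^ 2) + s ^ 4) := by
    simp only [weight, Function.iterate_one, diamondStep]
    ring
  have hB : (weight (-s ^ 2) q 1).2 = (q - 2 * s ^ 2) ^ 2 := by
    simp only [weight, Function.iterate_one, diamondStep]
    ring
  refine ⟨by rw [hA]; positivity, ?_⟩
  rw [hA, hB]
  field_simp

theorem qCrit_neg_sq {s : ℝ} (hs : 0 ≤ s) : qCrit (-s ^ 2) = s * (s * (2 + s)) := by
  rw [qCrit, neg_neg, Real.sqrt_sq hs]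
  ring

/-- Above `q_c` the weight starts, after one step, below the repelling fixed point. -/
theorem tendsto_of_qCrit_lt {s q : ℝ} (hs : 0 < s) (hq : qCrit (-s ^ 2) < q) :
    Tendsto (transmissivity (-s ^ 2) q) atTop (𝓝 0) ∧
      ∃ᶠ m in atTop, (weight (-s ^ 2) q m).1 + q * (weight (-s ^ 2) q m).2 ≠ 0 := by
  rw [qCrit_neg_sq hs.le] at hq
  have hq2 : 2 * s ^ 2 < q := by nlinarith [pow_pos hs 3]
  have hq0 : 0 < q := by nlinarith
  have hc := hasCoord_one hs hq2
  set w := s ^ 4 / (q - 2 * s ^ 2) with hw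
  have hw0 : 0 < w := div_pos (by positivity) (by linarith)
  have hws : w < s := by
    rw [hw, div_lt_iff₀ (by linarith)]
    nlinarith
  have hV : w * (2 + w) < s * (2 + s) := by gcongr
  -- `V` is the weight at `q = q_c`, which is a fixed point there
  set V := s * (2 + s) with hVd
  have hV0 : 0 < V := by positivity
  set X := q / (w * (2 + w)) with hX
  have hsV : s < q / V := by rw [lt_div_iff₀ (by positivity)]; exact hq
  have hXY : q / V < X := by rw [hX]; gcongr
  have hVX : V < X * (X + 2) := by nlinarith
  have hX0 : 0 < X := by positivity
  refine tendsto_of_hasCoord hq0.ne' hc hX0 ?_ (by positivity)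
  calc q = q / V * V := (div_mul_cancel₀ _ hV0.ne').symm
    _ < X * (X * (X + 2)) := by gcongr
    _ = _ := by ring

/-- Slightly below `q_c` the weight starts, after one step, above the repelling fixed point. -/
theorem not_tendsto_of_lt_qCrit {s q : ℝ} (hs : 0 < s) (hq2 : 2 * s ^ 2 < q)
    (hq : q < qCrit (-s ^ 2)) : ¬ Tendsto (transmissivity (-s ^ 2) q) atTop (𝓝 0) := by
  rw [qCrit_neg_sq hs.le] at hq
  have hq0 : 0 < q := by nlinarith
  have hc := hasCoord_one hs hq2
  set w := s ^ 4 / (q - 2 * s ^ 2) with hw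
  have hws : s < w := by
    rw [hw, lt_div_iff₀ (by linarith)]
    nlinarith
  have hw0 : 0 < w := hs.trans hws
  have hV : s * (2 + s) < w * (2 + w) := by gcongr
  set V := s * (2 + s) with hVd
  have hV0 : 0 < V := by positivity
  have hsV : q / V < s := by rw [div_lt_iff₀ (by positivity)]; exact hq
  have hY0 : 0 < q / V := by positivity
  refine not_tendsto_of_hasCoord_le (s := q / V) hq0 ?_ hc (by positivity) (by gcongr)
  have h1 : q / V * (q / V + 2) ≤ V := by rw [hVd] at *; nlinarith
  calc (q / V) ^ 2 * (q / V + 2) = q / V * (q / V * (q / V + 2)) := by ring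
    _ ≤ q / V * V := by gcongr
    _ = q := by field_simp

/-- For negative `q` the weight tends to `0`. -/
theorem tendsto_of_neg {v q : ℝ} (hv1 : -1 ≤ v) (hv0 : v < 0) (hq : q < 0) :
    Tendsto (transmissivity v q) atTop (𝓝 0) ∧
      ∃ᶠ m in atTop, (weight v q m).1 + q * (weight v q m).2 ≠ 0 := by
  have hX : -q ≤ q / v := by
    rw [le_div_iff_of_neg hv0]
    nlinarith
  have hX0 : 0 < q / v := by linarith
  refine tendsto_of_hasCoord hq.ne (hasCoord_zero hv0.ne q) hX0 ?_ ?_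
  · exact hq.trans (by positivity)
  · nlinarith

theorem zero_mem_zeroLocus {v : ℝ} (hv1 : -1 ≤ v) (hv0 : v < 0) :
    (0 : ℂ) ∈ zeroLocus (v : ℂ) := by
  rw [← Complex.ofReal_zero]
  refine mem_zeroLocus_ofReal ?_ ?_
  · have : ∀ᶠ q : ℝ in 𝓝[<] 0, Tendsto (transmissivity v q) atTop (𝓝 0) :=
      eventually_mem_nhdsWithin.mono fun q hq => (tendsto_of_neg hv1 hv0 hq).1
    exact this.frequently.filter_mono (nhdsWithin_mono _ fun y hy => ne_of_lt hy)
  · have : ∀ᶠ q : ℝ in 𝓝[>] 0, ¬ Tendsto (transmissivity v q) atTop (𝓝 0) := by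
      filter_upwards [Ioo_mem_nhdsGT (show (0 : ℝ) < min (-v / 2) (3 / 8) from
        lt_min (by linarith) (by norm_num))] with q hq
      exact not_tendsto_of_small hv1 hv0 hq.1 (hq.2.le.trans (min_le_left _ _))
        (hq.2.le.trans (min_le_right _ _))
    exact this.frequently.filter_mono (nhdsWithin_mono _ fun y hy => ne_of_gt hy)

theorem qCrit_mem_zeroLocus {s : ℝ} (hs : 0 < s) :
    ((qCrit (-s ^ 2) : ℝ) : ℂ) ∈ zeroLocus ((-s ^ 2 : ℝ) : ℂ) := by
  refine mem_zeroLocus_ofReal ?_ ?_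
  · have : ∀ᶠ q in 𝓝[>] (qCrit (-s ^ 2)), Tendsto (transmissivity (-s ^ 2) q) atTop (𝓝 0) :=
      eventually_mem_nhdsWithin.mono fun q hq => (tendsto_of_qCrit_lt hs hq).1
    exact this.frequently.filter_mono (nhdsWithin_mono _ fun y hy => ne_of_gt hy)
  · have h : 2 * s ^ 2 < qCrit (-s ^ 2) := by
      rw [qCrit_neg_sq hs.le]
      nlinarith [pow_pos hs 3]
    have : ∀ᶠ q in 𝓝[<] (qCrit (-s ^ 2)), ¬ Tendsto (transmissivity (-s ^ 2) q) atTop (𝓝 0) := by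
      filter_upwards [Ioo_mem_nhdsLT h] with q hq using not_tendsto_of_lt_qCrit hs hq.1 hq.2
    exact this.frequently.filter_mono (nhdsWithin_mono _ fun y hy => ne_of_lt hy)

theorem mem_Icc_of_mem_zeroLocus {s x : ℝ} (hs : 0 < s) (hs1 : s ≤ 1)
    (hx : (x : ℂ) ∈ zeroLocus ((-s ^ 2 : ℝ) : ℂ)) : x ∈ Set.Icc 0 (qCrit (-s ^ 2)) := by
  have key : x ≠ 0 → ¬ (Tendsto (transmissivity (-s ^ 2) x) atTop (𝓝 0) ∧
      ∃ᶠ m in atTop, (weight (-s ^ 2) x m).1 + x * (weight (-s ^ 2) x m).2 ≠ 0) := by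
    rintro hx0 ⟨h1, h2⟩
    refine not_mem_zeroLocus_of_tendsto (by exact_mod_cast hx0) (h2.mono fun m hm => ?_)
      (tendsto_transmissivity_ofReal.2 h1) hx
    rw [weight_ofReal]
    dsimp only
    exact_mod_cast hm
  constructor
  · by_contra! h
    exact key h.ne (tendsto_of_neg (by nlinarith) (by nlinarith) h)
  · by_contra! h
    have : 0 < qCrit (-s ^ 2) := by rw [qCrit_neg_sq hs.le]; positivity
    exact key (this.trans h).ne' (tendsto_of_qCrit_lt hs h)

/-- In the first regime `q_∞` is the parameter `32 / 27` of a saddle-node bifurcation at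
`ξ = 4 / 3`, the maximum of `ξ² (2 - ξ)`. -/
theorem qInfty_spec_of_le {v : ℝ} (hv1 : -1 ≤ v) (hv : v ≤ -8 / 9) :
    (∀ n, 0 < 2 * (xi v (32 / 27) n * (2 - xi v (32 / 27) n)) - 32 / 27 ∧
      xi v (32 / 27) n < 2) ∧
    ∀ q, 32 / 27 < q → ∀ y, -(q / v) ≤ y → y ^ 2 * (2 - y) < q := by
  constructor
  · have key : ∀ n, 1 ≤ xi v (32 / 27) n ∧ xi v (32 / 27) n ≤ 4 / 3 := by
      intro n
      induction n with
      | zero =>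
        rw [xi, ← div_neg]
        constructor
        · rw [le_div_iff₀ (by linarith)]; linarith
        · rw [div_le_iff₀ (by linarith)]; linarith
      | succ n ih =>
        rw [xi]
        have h1 : 8 / 9 ≤ xi v (32 / 27) n * (2 - xi v (32 / 27) n) := by nlinarith
        have h2 : xi v (32 / 27) n * (2 - xi v (32 / 27) n) ≤ 1 := by nlinarith
        generalize xi v (32 / 27) n * (2 - xi v (32 / 27) n) = S at *
        have hd : 0 < 2 * S - 32 / 27 := by linarith
        constructor
        · rw [le_div_iff₀ hd]
          nlinarith [sq_nonneg (S - 1)]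
        · rw [div_le_iff₀ hd]
          nlinarith
    intro n
    obtain ⟨h1, h2⟩ := key n
    exact ⟨by nlinarith, by linarith⟩
  · intro q hq y hy
    have h0 : 0 < -(q / v) := by
      rw [← div_neg]
      exact div_pos (by linarith) (by linarith)
    have hy0 : 0 < y := h0.trans_le hy
    nlinarith [mul_nonneg (sq_nonneg (y - 4 / 3)) (by linarith : (0 : ℝ) ≤ y + 2 / 3)]

/-- In the second regime, with `v = r ^ 2 - 1`, the orbit starts at `q = q_∞` in the repelling
fixed point `ξ = 1 + r`. -/
theorem qInfty_spec_of_ge {r : ℝ} (hr : 1 / 3 ≤ r) (hr1 : r < 1) :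
    (∀ n, 0 < 2 * (xi (r ^ 2 - 1) ((1 + r) * (1 - r ^ 2)) n *
        (2 - xi (r ^ 2 - 1) ((1 + r) * (1 - r ^ 2)) n)) - (1 + r) * (1 - r ^ 2) ∧
      xi (r ^ 2 - 1) ((1 + r) * (1 - r ^ 2)) n < 2) ∧
    ∀ q, (1 + r) * (1 - r ^ 2) < q → ∀ y, -(q / (r ^ 2 - 1)) ≤ y → y ^ 2 * (2 - y) < q := by
  have h1 : 0 < 1 - r ^ 2 := by nlinarith
  have h2 : 0 < 1 - r := by linarith
  have hd : 2 * ((1 + r) * (2 - (1 + r))) - (1 + r) * (1 - r ^ 2) = (1 - r ^ 2) * (1 - r) := by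
    ring
  have key : ∀ n, xi (r ^ 2 - 1) ((1 + r) * (1 - r ^ 2)) n = 1 + r := by
    intro n
    induction n with
    | zero =>
      rw [xi, ← div_neg, neg_sub]
      field_simp
    | succ n ih =>
      rw [xi, ih, hd, div_eq_iff (by positivity)]
      ring
  constructor
  · intro n
    rw [key, hd]
    exact ⟨by positivity, by linarith⟩
  · intro q hq y hy
    rw [← div_neg, neg_sub, div_le_iff₀ h1] at hy
    have hp : 1 + r ≤ y := by nlinarith
    refine lt_of_le_of_lt ?_ hq
    have h3 : 0 ≤ (y - (1 + r)) * (y * (y + r - 1) + (1 + r) * (r - 1)) := by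
      refine mul_nonneg (by linarith) ?_
      have : (1 + r) * (2 * r) ≤ y * (y + r - 1) := by gcongr <;> linarith
      nlinarith
    nlinarith

theorem exists_mem_zeroLocus_near_qInfty {v : ℝ} (hv1 : -1 ≤ v) (hv0 : v < 0) {q₀ : ℝ}
    (hq₀ : qInfty v < q₀) :
    ∃ q, qInfty v < q ∧ q ≤ q₀ ∧ (q : ℂ) ∈ zeroLocus (v : ℂ) := by
  obtain ⟨hpos, hinf, hesc⟩ : 0 < qInfty v ∧
      (∀ n, 0 < 2 * (xi v (qInfty v) n * (2 - xi v (qInfty v) n)) - qInfty v ∧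
        xi v (qInfty v) n < 2) ∧
      ∀ q, qInfty v < q → ∀ y, -(q / v) ≤ y → y ^ 2 * (2 - y) < q := by
    rcases le_or_gt v (-8 / 9) with h | h
    · rw [qInfty, if_pos h]
      exact ⟨by norm_num, qInfty_spec_of_le hv1 h⟩
    · rw [qInfty, if_neg h.not_ge]
      set r := √(1 + v) with hr
      have hr0 : 0 ≤ r := Real.sqrt_nonneg _
      have hv : v = r ^ 2 - 1 := by rw [hr, Real.sq_sqrt (by linarith)]; ring
      have hr3 : 1 / 3 ≤ r := by nlinarith
      have hr1 : r < 1 := by nlinarith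
      have e : (-1 - r) * v = (1 + r) * (1 - r ^ 2) := by rw [hv]; ring
      rw [e]
      clear_value r
      subst hv
      exact ⟨mul_pos (by linarith) (by nlinarith), qInfty_spec_of_ge hr3 hr1⟩
  -- shrink the interval to avoid the exceptional value `q = 1`
  rcases lt_or_ge (qInfty v) 1 with h | h
  · obtain ⟨c, hc, hc'⟩ := exists_between (lt_min hq₀ h)
    obtain ⟨q, h1, h2, h3⟩ := exists_mem_zeroLocus_of_escape hv0 hpos hc
      (fun x hx => ((hx.2.trans_lt hc').trans_le (min_le_right _ _)).ne) hinf hesc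
    exact ⟨q, h1, h2.trans (hc'.le.trans (min_le_left _ _)), h3⟩
  · exact exists_mem_zeroLocus_of_escape hv0 hpos hq₀ (fun x hx => (h.trans_lt hx.1).ne') hinf hesc

/-- The accumulation locus contains its own accumulation points. -/
theorem mem_zeroLocus_of_tendsto {v q : ℂ} {u : ℕ → ℂ} (hu : ∀ k, u k ∈ zeroLocus v)
    (hne : ∀ k, u k ≠ q) (h : Tendsto u atTop (𝓝 q)) : q ∈ zeroLocus v := by
  intro ε hε
  obtain ⟨k, hk⟩ := (h.eventually (Metric.ball_mem_nhds q hε)).exists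
  have hpos : 0 < dist (u k) q := dist_pos.2 (hne k)
  have hlt : dist (u k) q < ε := hk
  refine (hu k (min (ε - dist (u k) q) (dist (u k) q)) (lt_min (by linarith) hpos)).mono ?_
  rintro m ⟨z, -, hzd, hz⟩
  refine ⟨z, ?_, ?_, hz⟩
  · rintro rfl
    rw [dist_comm] at hzd
    exact (hzd.trans_le (min_le_right _ _)).false
  · have := hzd.trans_le (min_le_left _ _)
    linarith [dist_triangle z (u k) q]

theorem exists_seq_tendsto_qInfty {v : ℝ} (hv1 : -1 ≤ v) (hv0 : v < 0) :
    (∃ q : ℕ → ℝ, Function.Injective q ∧ (∀ k, (q k : ℂ) ∈ zeroLocus (v : ℂ)) ∧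
      Tendsto q atTop (𝓝 (qInfty v))) ∧ ((qInfty v : ℝ) : ℂ) ∈ zeroLocus (v : ℂ) := by
  set T := {q : ℝ | qInfty v < q ∧ (q : ℂ) ∈ zeroLocus (v : ℂ)} with hT
  have hex : ∀ q₀, qInfty v < q₀ → ∃ q ∈ T, q ≤ q₀ := fun q₀ h => by
    obtain ⟨q, h1, h2, h3⟩ := exists_mem_zeroLocus_near_qInfty hv1 hv0 h
    exact ⟨q, ⟨h1, h3⟩, h2⟩
  have hglb : IsGLB T (qInfty v) := by
    refine ⟨fun q hq => hq.1.le, fun b hb => ?_⟩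
    refine le_of_forall_gt_imp_ge_of_dense fun c hc => ?_
    obtain ⟨q, hq, hqc⟩ := hex c hc
    exact (hb hq).trans hqc
  obtain ⟨q₁, hq₁, -⟩ := hex (qInfty v + 1) (by linarith)
  obtain ⟨u, hanti, hgt, hlim, hmem⟩ :=
    hglb.exists_seq_strictAnti_tendsto_of_notMem (fun h => h.1.false) ⟨q₁, hq₁⟩
  refine ⟨⟨u, hanti.injective, fun k => (hmem k).2, hlim⟩, ?_⟩
  exact mem_zeroLocus_of_tendsto (u := fun k => (u k : ℂ)) (fun k => (hmem k).2)
    (fun k h => (hgt k).ne' (Complex.ofReal_injective h))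
    ((Complex.continuous_ofReal.tendsto _).comp hlim)

theorem mainTheorem1 :
    (∀ v₀ : ℝ, -1 ≤ v₀ → v₀ < 0 →
      (0 : ℂ) ∈ zeroLocus (v₀ : ℂ) ∧
      0 < qCrit v₀ ∧
      ((qCrit v₀ : ℝ) : ℂ) ∈ zeroLocus (v₀ : ℂ) ∧
      (∀ x : ℝ, (x : ℂ) ∈ zeroLocus (v₀ : ℂ) → x ∈ Set.Icc 0 (qCrit v₀)) ∧
      (∃ q : ℕ → ℝ, Function.Injective q ∧
        (∀ k, (q k : ℂ) ∈ zeroLocus (v₀ : ℂ)) ∧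
        Tendsto q atTop (𝓝 (qInfty v₀))) ∧
      ((qInfty v₀ : ℝ) : ℂ) ∈ zeroLocus (v₀ : ℂ)) ∧
    -- the chromatic case `v₀ = -1`
    ((0 : ℂ) ∈ zeroLocus (-1) ∧ (3 : ℂ) ∈ zeroLocus (-1) ∧ (32 / 27 : ℂ) ∈ zeroLocus (-1) ∧
      (∃ q : ℕ → ℝ, Function.Injective q ∧
        (∀ k, (q k : ℂ) ∈ zeroLocus (-1)) ∧
        Tendsto q atTop (𝓝 (32 / 27)))) := by
  have main : ∀ v₀ : ℝ, -1 ≤ v₀ → v₀ < 0 →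
      (0 : ℂ) ∈ zeroLocus (v₀ : ℂ) ∧
      0 < qCrit v₀ ∧
      ((qCrit v₀ : ℝ) : ℂ) ∈ zeroLocus (v₀ : ℂ) ∧
      (∀ x : ℝ, (x : ℂ) ∈ zeroLocus (v₀ : ℂ) → x ∈ Set.Icc 0 (qCrit v₀)) ∧
      (∃ q : ℕ → ℝ, Function.Injective q ∧
        (∀ k, (q k : ℂ) ∈ zeroLocus (v₀ : ℂ)) ∧
        Tendsto q atTop (𝓝 (qInfty v₀))) ∧
      ((qInfty v₀ : ℝ) : ℂ) ∈ zeroLocus (v₀ : ℂ) := by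
    intro v hv1 hv0
    have hzero := zero_mem_zeroLocus hv1 hv0
    have hseq := exists_seq_tendsto_qInfty hv1 hv0
    obtain ⟨s, hs, rfl⟩ : ∃ s : ℝ, 0 < s ∧ v = -s ^ 2 :=
      ⟨√(-v), Real.sqrt_pos.2 (by linarith), by rw [Real.sq_sqrt (by linarith)]; ring⟩
    refine ⟨hzero, ?_, qCrit_mem_zeroLocus hs,
      fun x hx => mem_Icc_of_mem_zeroLocus hs (by nlinarith) hx, hseq⟩
    rw [qCrit_neg_sq hs.le]
    positivity
  refine ⟨main, ?_⟩
  obtain ⟨h1, -, h2, -, h3, h4⟩ := main (-1) le_rfl (by norm_num)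
  have e1 : qCrit (-1) = 3 := by norm_num [qCrit]
  have e2 : qInfty (-1) = 32 / 27 := by norm_num [qInfty]
  rw [e1] at h2
  rw [e2] at h3 h4
  push_cast at h1 h2 h3 h4
  exact ⟨h1, h2, h4, h3⟩
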